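/- **Setting.** Let $X$ be a finite set with a metric $d_X$, let $A$ be a finite set, let $0\le\beta<1$, and write $\mathcal P(X),\mathcal P(A)$ for the simplices of probability measures and $\|\mu-\nu\|_{TV}=\frac12\sum_{x}|\mu(x)-\nu(x)|$. A pair $(c,p)$ consists of a one-stage cost $c:X\times A\times\mathcal P(X)\to\mathbb R$ and a transition probability $p:X\times A\times\mathcal P(X)\to\mathcal P(X)$; for $u\in\mathcal P(A)$ put $$C(x,u,\mu)=\sum_{a}c(x,a,\mu)u(a),\qquad P(\cdot|x,u,\mu)=\sum_a p(\cdot|x,a,\mu)u(a).$$ Let $\Omega:\mathcal P(A)\to\mathbb R$ be continuous and $\rho$-strongly convex with respect to $\|\cdot\|_1$, $\rho>0$, i.e. $\Omega(su+tv)\le s\Omega(u)+t\Omega(v)-st\frac{\rho}{2}\|u-v\|_1^2$ for $u,v\in\mathcal P(A)$, $s,t\ge0$, $s+t=1$. A (randomized) policy is a stochastic kernel $\pi(du|x)$ from $X$ to $\mathcal P(A)$, and $(\pi\otimes\mu)(dx,du)=\pi(du|x)\mu(dx)$. $W_1$ is the 1-Wasserstein distance on $X\times\mathcal P(A)$, $W_1(\kappa,\kappa')=\sup_g|\int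 g\,d\kappa-\int g\,d\kappa'|$ over all $g$ that are 1-Lipschitz for $d_X(x,x')+\|u-u'\|_1$. A *finite-horizon MFE* of the regularized game $\mathrm{MFG}_T=(X,\mathcal P(A),C+\Omega,P,\mu_0,T)$ is a pair $(\pi_t,\mu_t)_{t=0}^T$ of policies and state measures, starting from the given $\mu_0$, with $\mu_{t+1}(\cdot)=\int P(\cdot|x,u,\mu_t)\,(\pi_t\otimes\mu_t)(dx,du)$ for $t<T$, such that $(\pi_t)_t$ minimizes $E^{\tilde\pi}\big[\sum_{t=0}^T\beta^t\big(C(x_t,u_t,\mu_t)+\Omega(u_t)\big)\big]$ over all Markov policies $\tilde\pi=(\tilde\pi_t)_t$, where $x_0\sim\mu_0$, $u_t\sim\tilde\pi_t(\cdot|x_t)$, $x_{t+1}\sim P(\cdot|x_t,u_t,\mu_t)$. A *stationary MFE* of $\mathrm{MFG}_s=(X,\mathcal P(A),C+\Omega,P)$ is a pair $(\pi,\mu)$ of a policy and a state measure with $\mu(\cdot)=\int P(\cdot|x,u,\mu)\,(\pi\otimes\mu)(dx,du)$ such that the time-independent policy $\pi$ minimizes $E^{\tilde\pi}\big[\sum_{t=0}^\infty\beta^t\big(C(x_t,u_t,\mu)+\Omega(u_t)\big)\big]$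 over all Markov policies, where $x_0\sim\mu$, $u_t\sim\tilde\pi_t(\cdot|x_t)$ and $x_{t+1}\sim P(\cdot|x_t,u_t,\mu)$. We say that $(c,p)$ satisfies the *contraction condition* with constants $L_1,K_1\ge0$ if for all arguments $$|c(x,a,\mu)-c(\hat x,\hat a,\hat\mu)|\le L_1\big(1_{x\ne\hat x}+2\cdot1_{a\ne\hat a}+2\|\mu-\hat\mu\|_{TV}\big),$$ $$\|p(\cdot|x,a,\mu)-p(\cdot|\hat x,\hat a,\hat\mu)\|_{TV}\le\tfrac{K_1}{2}\big(1_{x\ne\hat x}+2\cdot1_{a\ne\hat a}+2\|\mu-\hat\mu\|_{TV}\big),$$ and $\frac{\beta K_1}{2}<1$ and $$\bar K+\frac{\bar LK_1}{\rho(1-\beta)}<1,\qquad\text{where }\ \bar L=L_1+\beta\frac{L_1K_1}{1-\beta K_1/2},\quad \bar K=\frac{3K_1}{2}+\frac{K_1\bar L}{2\rho(1-\beta)}.$$ **Statement.** Let $(c,p)$ and $(\bar c,\bar p)$ both satisfy the contraction condition, each with constants of its own, with the same $\beta,\Omega,\rho$; let $\mathrm{MFG}_T,\mathrm{MFG}_s$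 and $\overline{\mathrm{MFG}}_T,\overline{\mathrm{MFG}}_s$ be the corresponding regularized games, the finite-horizon ones with a common initial measure $\mu_0$. Let $\epsilon\in\mathbb R$ and suppose that for all sufficiently large $T$ there are finite-horizon MFE $(\pi^T_t,\mu^T_t)_{t=0}^T$ of $\mathrm{MFG}_T$ and $(\bar\pi^T_t,\bar\mu^T_t)_{t=0}^T$ of $\overline{\mathrm{MFG}}_T$ with $$W_1\big(\pi^T_t\otimes\mu^T_t,\ \bar\pi^T_t\otimes\bar\mu^T_t\big)<\epsilon\qquad\text{for all }0\le t\le T;$$ in the degenerate case $\beta=0$ suppose moreover that for all sufficiently large $T$ this holds for every pair of such MFE. Then for every stationary MFE $(\pi,\mu)$ of $\mathrm{MFG}_s$ and every stationary MFE $(\bar\pi,\bar\mu)$ of $\overline{\mathrm{MFG}}_s$, $$W_1(\pi\otimes\mu,\ \bar\pi\otimes\bar\mu)<3\epsilon.$$ -/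

import Mathlib

open MeasureTheory ProbabilityTheory Filter
open scoped ENNReal

noncomputable section

namespace MeanFieldGame

/-- Probability measures on a finite set, as points of the standard simplex. -/
abbrev Prob (S : Type*) [Fintype S] : Type _ := stdSimplex ℝ S

/-- Total variation distance, one half of the `ℓ¹` distance. -/
def tv {S : Type*} [Fintype S] (μ ν : Prob S) : ℝ := (1 / 2) * ∑ s, |μ s - ν s|

/-- A point of the simplex as a measure. -/
def toMeasure {S : Type*} [Fintype S] [MeasurableSpace S] (μ : Prob S) : Measure S :=
  ∑ s, ENNReal.ofReal (μ s) • Measure.dirac s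

/-- System components over finite state space `X` and finite action space `A`: the one-stage cost
`c(x,a,μ)` and the transition probability `p(· | x,a,μ)`. -/
structure Game (X A : Type*) [Fintype X] where
  cost : X → A → Prob X → ℝ
  trans : X → A → Prob X → Prob X

variable {X A : Type*} [Fintype X] [Fintype A]

/-- `C(x,u,μ) = ∑ₐ c(x,a,μ) u(a)` for `u ∈ 𝒫(A)`. -/
def Game.liftCost (G : Game X A) (x : X) (u : Prob A) (μ : Prob X) : ℝ :=
  ∑ a, G.cost x a μ * u a

/-- `P(y | x,u,μ) = ∑ₐ p(y | x,a,μ) u(a)` for `u ∈ 𝒫(A)`. -/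
def Game.liftTrans (G : Game X A) (x : X) (u : Prob A) (μ : Prob X) (y : X) : ℝ :=
  ∑ a, G.trans x a μ y * u a

open Classical in
/-- Lipschitz bounds for `c` (constant `L`) and `p` (constant `K / 2`). -/
def Game.IsLipschitz (G : Game X A) (L K : ℝ) : Prop :=
  (∀ x x' a a' μ μ', |G.cost x a μ - G.cost x' a' μ'| ≤
      L * ((if x = x' then 0 else 1) + 2 * (if a = a' then 0 else 1) + 2 * tv μ μ')) ∧
  (∀ x x' a a' μ μ', tv (G.trans x a μ) (G.trans x' a' μ') ≤
      K / 2 * ((if x = x' then 0 else 1) + 2 * (if a = a' then 0 else 1) + 2 * tv μ μ'))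

/-- `Ω` is `ρ`-strongly convex on `𝒫(A)` with respect to the `ℓ¹` norm. -/
def StronglyConvex (ρ : ℝ) (Ω : (A → ℝ) → ℝ) : Prop :=
  ∀ u ∈ stdSimplex ℝ A, ∀ v ∈ stdSimplex ℝ A, ∀ s t : ℝ, 0 ≤ s → 0 ≤ t → s + t = 1 →
    Ω (s • u + t • v) ≤ s * Ω u + t * Ω v - s * t * (ρ / 2 * (∑ a, |u a - v a|) ^ 2)

/-- A regularizer: continuous and `ρ`-strongly convex on `𝒫(A)`, with `ρ > 0`. -/
structure IsRegularizer (ρ : ℝ) (Ω : (A → ℝ) → ℝ) : Prop where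
  pos : 0 < ρ
  continuousOn : ContinuousOn Ω (stdSimplex ℝ A)
  stronglyConvex : StronglyConvex ρ Ω

/-- `L̄ = L₁ + β L₁ K₁ / (1 - β K₁ / 2)`. -/
def Lbar (β L K : ℝ) : ℝ := L + β * (L * K / (1 - β * K / 2))

/-- `K̄ = 3 K₁ / 2 + K₁ L̄ / (2 ρ (1 - β))`. -/
def Kbar (β ρ L K : ℝ) : ℝ := 3 * K / 2 + K * Lbar β L K / (2 * ρ * (1 - β))

/-- The contraction condition `K̄ + L̄ K₁ / (ρ (1 - β)) < 1`, for nonnegative Lipschitz constants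
for which the geometric series with ratio `β K₁ / 2` behind `L̄` converges. -/
def Game.Contracts (G : Game X A) (β ρ L K : ℝ) : Prop :=
  0 ≤ L ∧ 0 ≤ K ∧ G.IsLipschitz L K ∧ β * K / 2 < 1 ∧
    Kbar β ρ L K + Lbar β L K * K / (ρ * (1 - β)) < 1

variable [MeasurableSpace X]

/-- A (one-step, randomized) policy of the regularized game, whose action space is `𝒫(A)`. -/
abbrev Policy (X A : Type*) [Fintype A] [MeasurableSpace X] : Type _ := Kernel X (Prob A)

/-- `π ⊗ μ (du, dx) = π(du | x) μ(dx)`. -/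
def joint (π : Policy X A) (μ : Prob X) : Measure (X × Prob A) := toMeasure μ ⊗ₘ π

/-- Law of the next state if the current state has law `ν`, the action is drawn from `π` and the
population is distributed according to `m`. -/
def Game.nextLaw (G : Game X A) (m : Prob X) (π : Policy X A) (ν : Measure X) : Measure X :=
  ∑ y, ENNReal.ofReal (∫ z, G.liftTrans z.1 z.2 m y ∂(ν ⊗ₘ π)) • Measure.dirac y

/-- Law of the state `x_t` of a player who uses the Markov policy `π` and starts from `x_0 ∼ ν₀`,
while the population evolves along the fixed flow `μ`. -/
def Game.stateLaw (G : Game X A) (ν₀ : Prob X) (μ : ℕ → Prob X) (π : ℕ → Policy X A) :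
    ℕ → Measure X
  | 0 => toMeasure ν₀
  | t + 1 => G.nextLaw (μ t) (π t) (Game.stateLaw G ν₀ μ π t)

/-- `E^π[C(x_t,u_t,μ_t) + Ω(u_t)]`; the pair `(x_t,u_t)` has law `stateLaw t ⊗ₘ π_t`. -/
def Game.stageCost (G : Game X A) (Ω : (A → ℝ) → ℝ) (ν₀ : Prob X) (μ : ℕ → Prob X)
    (π : ℕ → Policy X A) (t : ℕ) : ℝ :=
  ∫ z, (G.liftCost z.1 z.2 (μ t) + Ω z.2) ∂(G.stateLaw ν₀ μ π t ⊗ₘ π t)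

/-- Discounted cost over the times `0, …, T`. -/
def Game.finiteCost (G : Game X A) (Ω : (A → ℝ) → ℝ) (β : ℝ) (T : ℕ) (ν₀ : Prob X)
    (μ : ℕ → Prob X) (π : ℕ → Policy X A) : ℝ :=
  ∑ t ∈ Finset.range (T + 1), β ^ t * G.stageCost Ω ν₀ μ π t

/-- Discounted cost over the infinite horizon. -/
def Game.infiniteCost (G : Game X A) (Ω : (A → ℝ) → ℝ) (β : ℝ) (ν₀ : Prob X)
    (μ : ℕ → Prob X) (π : ℕ → Policy X A) : ℝ :=
  ∑' t, β ^ t * G.stageCost Ω ν₀ μ π t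

/-- Mean-field equilibria of the regularized game `(X, 𝒫(A), C + Ω, P, μ₀, T)`. Only the values at
the times `0, …, T` matter. -/
structure Game.IsFiniteMFE (G : Game X A) (Ω : (A → ℝ) → ℝ) (β : ℝ) (μ₀ : Prob X) (T : ℕ)
    (π : ℕ → Policy X A) (μ : ℕ → Prob X) : Prop where
  markov : ∀ t, IsMarkovKernel (π t)
  init : μ 0 = μ₀
  flow : ∀ t < T, ∀ y, μ (t + 1) y = ∫ z, G.liftTrans z.1 z.2 (μ t) y ∂(joint (π t) (μ t))
  optimal : ∀ π' : ℕ → Policy X A, (∀ t, IsMarkovKernel (π' t)) →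
    G.finiteCost Ω β T μ₀ μ π ≤ G.finiteCost Ω β T μ₀ μ π'

/-- Stationary mean-field equilibria of the regularized game `(X, 𝒫(A), C + Ω, P)`: the state
measure `μ` is invariant and the time-independent policy `π` is optimal, for a player whose initial
state has law `μ`, among all Markov policies. -/
structure Game.IsStationaryMFE (G : Game X A) (Ω : (A → ℝ) → ℝ) (β : ℝ)
    (π : Policy X A) (μ : Prob X) : Prop where
  markov : IsMarkovKernel π
  flow : ∀ y, μ y = ∫ z, G.liftTrans z.1 z.2 μ y ∂(joint π μ)
  optimal : ∀ π' : ℕ → Policy X A, (∀ t, IsMarkovKernel (π' t)) →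
    G.infiniteCost Ω β μ (fun _ => μ) (fun _ => π) ≤ G.infiniteCost Ω β μ (fun _ => μ) π'

/-- The Wasserstein-1 distance on `X × 𝒫(A)`, in its dual form, for the ground metric
`d((x,u),(x',u')) = d_X(x,x') + ‖u - u'‖₁`. -/
def W1 [MetricSpace X] (P Q : Measure (X × Prob A)) : ℝ≥0∞ :=
  ⨆ (g : X × Prob A → ℝ)
    (_ : ∀ z z', |g z - g z'| ≤ dist z.1 z'.1 + ∑ a, |z.2 a - z'.2 a|),
    ENNReal.ofReal |∫ z, g z ∂P - ∫ z, g z ∂Q|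

end MeanFieldGame

end

/-! This is a turnpike argument. In a finite-horizon equilibrium the policy at each time is the best
response to the optimal value of the remaining horizon (`Game.IsFiniteMFE.ae_eq`), and in a
stationary equilibrium it is the best response to the fixed point of the Bellman operator
(`Game.IsStationaryMFE.ae_eq`). Strong convexity makes the best response single-valued and
`1/ρ`-Lipschitz in the action costs.

The distance of the population flow to the stationary measure propagates forwards in time. The
distance between the action costs propagates backwards with factor `β`. The contraction condition is
a small-gain condition for this coupled system, so both errors decay geometrically in the distance
to the two ends of the horizon (`exists_interior_decay`). Mid-horizon state-action laws of each game
therefore approach that of any stationary equilibrium (`Game.Contracts.exists_abs_integral_sub_le`).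

Comparing the two games at such a time bounds the stationary distance by `ε + η` for every `η > 0`,
hence by `ε`, which is less than `3ε` because the hypothesis forces `ε > 0`.

For `β = 0` the cost sees only time `0` and later play is unconstrained; there the extra hypothesis
is applied to the equilibria that stay greedy at all times. -/

noncomputable section

namespace MeanFieldGame

/-! ### Probability vectors and `ℓ¹` estimates. -/

section Simplex

variable {S R : Type*} [Fintype S] [Fintype R]

/-- The `ℓ¹` distance. -/
def l1 (u v : S → ℝ) : ℝ := ∑ s, |u s - v s|

lemma l1_nonneg (u v : S → ℝ) : 0 ≤ l1 u v := Finset.sum_nonneg fun _ _ => abs_nonneg _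

lemma l1_comm (u v : S → ℝ) : l1 u v = l1 v u :=
  Finset.sum_congr rfl fun _ _ => abs_sub_comm _ _

lemma l1_triangle (u v w : S → ℝ) : l1 u w ≤ l1 u v + l1 v w := by
  rw [l1, l1, l1, ← Finset.sum_add_distrib]
  exact Finset.sum_le_sum fun _ _ => abs_sub_le _ _ _

lemma two_mul_tv (μ ν : Prob S) : 2 * tv μ ν = l1 μ ν := by
  rw [tv, l1]; ring

lemma Prob.sum_eq_one (μ : Prob S) : ∑ s, μ s = 1 := μ.2.2

lemma Prob.nonneg (μ : Prob S) (s : S) : 0 ≤ μ s := μ.2.1 s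

lemma Prob.nonempty (μ : Prob S) : Nonempty S := by
  by_contra h
  rw [not_nonempty_iff] at h
  simpa using Prob.sum_eq_one μ

lemma l1_le_two (μ ν : Prob S) : l1 μ ν ≤ 2 := by
  have h : l1 μ ν ≤ ∑ s, (μ s + ν s) := Finset.sum_le_sum fun s _ => by
    have h1 := Prob.nonneg μ s
    have h2 := Prob.nonneg ν s
    rw [abs_le]; constructor <;> linarith
  rw [Finset.sum_add_distrib, Prob.sum_eq_one, Prob.sum_eq_one] at h
  linarith

lemma abs_sum_mul_le (g : S → ℝ) (M : ℝ) (hg : ∀ s, |g s| ≤ M) (d : S → ℝ) :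
    |∑ s, g s * d s| ≤ M * ∑ s, |d s| := by
  refine (Finset.abs_sum_le_sum_abs _ _).trans ?_
  rw [Finset.mul_sum]
  refine Finset.sum_le_sum fun s _ => ?_
  rw [abs_mul]
  exact mul_le_mul_of_nonneg_right (hg s) (abs_nonneg _)

lemma Prob.abs_sum_mul_le (g : S → ℝ) (M : ℝ) (hg : ∀ s, |g s| ≤ M) (μ : Prob S) :
    |∑ s, g s * μ s| ≤ M := by
  have h := MeanFieldGame.abs_sum_mul_le g M hg (fun s => μ s)
  have h2 : ∑ s, |μ s| = 1 := by
    rw [← Prob.sum_eq_one μ]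
    exact Finset.sum_congr rfl fun s _ => abs_of_nonneg (Prob.nonneg μ s)
  rwa [h2, mul_one] at h

/-- Integrals of a function of oscillation at most `M` against two probability vectors. -/
lemma abs_sum_mul_sub_le (g : S → ℝ) (M : ℝ) (hg : ∀ s s', |g s - g s'| ≤ M) (μ ν : Prob S) :
    |∑ s, g s * (μ s - ν s)| ≤ M / 2 * l1 μ ν := by
  have := Prob.nonempty μ
  obtain ⟨i, hi⟩ := Finite.exists_max g
  obtain ⟨j, hj⟩ := Finite.exists_min g
  -- Equal total masses allow centring `g` at its midrange; this yields the factor 1/2.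
  have key : ∑ s, g s * (μ s - ν s) = ∑ s, (g s - (g i + g j) / 2) * (μ s - ν s) := by
    simp only [sub_mul, Finset.sum_sub_distrib]
    rw [← Finset.mul_sum, Finset.sum_sub_distrib, Prob.sum_eq_one, Prob.sum_eq_one]
    ring
  rw [key]
  refine abs_sum_mul_le _ _ (fun s => ?_) _
  have h1 := hi s
  have h2 := hj s
  have h3 := (abs_le.1 (hg i j)).2
  rw [abs_le]; constructor <;> linarith

/-- Dobrushin contraction. -/
lemma l1_mix_le (k : S → R → ℝ) (M : ℝ) (hk : ∀ s s', l1 (k s) (k s') ≤ M) (μ ν : Prob S) :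
    l1 (fun y => ∑ s, k s y * μ s) (fun y => ∑ s, k s y * ν s) ≤ M / 2 * l1 μ ν := by
  set d : R → ℝ := fun y => ∑ s, k s y * (μ s - ν s) with hd
  -- Testing against the signs of `d` reduces the claim to a scalar function of `s` with oscillation
  -- at most `M`.
  have h1 : l1 (fun y => ∑ s, k s y * μ s) (fun y => ∑ s, k s y * ν s)
      = ∑ s, (∑ y, (SignType.sign (d y) : ℝ) * k s y) * (μ s - ν s) := by
    have : ∀ y, (∑ s, k s y * μ s) - (∑ s, k s y * ν s) = d y := fun y => by
      simp only [hd, mul_sub, Finset.sum_sub_distrib]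
    simp only [l1, this]
    have h2 : ∀ y, |d y| = ∑ s, (SignType.sign (d y) : ℝ) * k s y * (μ s - ν s) := fun y => by
      rw [← sign_mul_self]
      conv_lhs => rw [hd]
      simp only [Finset.mul_sum, mul_assoc]
      rfl
    simp only [h2, Finset.sum_mul]
    exact Finset.sum_comm
  rw [h1]
  refine (le_abs_self _).trans (abs_sum_mul_sub_le _ _ (fun s s' => ?_) μ ν)
  refine le_trans ?_ (hk s s')
  rw [← Finset.sum_sub_distrib, l1]
  refine (Finset.abs_sum_le_sum_abs _ _).trans (Finset.sum_le_sum fun y _ => ?_)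
  rw [← mul_sub, abs_mul]
  refine mul_le_of_le_one_left (abs_nonneg _) ?_
  rcases lt_trichotomy (d y) 0 with h | h | h <;> simp [h]

lemma l1_mix_le_of_le (k k' : S → R → ℝ) (M : ℝ) (hk : ∀ s, l1 (k s) (k' s) ≤ M) (μ : Prob S) :
    l1 (fun y => ∑ s, k s y * μ s) (fun y => ∑ s, k' s y * μ s) ≤ M := by
  have h1 : l1 (fun y => ∑ s, k s y * μ s) (fun y => ∑ s, k' s y * μ s)
      ≤ ∑ y, ∑ s, |k s y - k' s y| * μ s := by
    refine Finset.sum_le_sum fun y _ => ?_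
    rw [← Finset.sum_sub_distrib]
    refine (Finset.abs_sum_le_sum_abs _ _).trans (Finset.sum_le_sum fun s _ => ?_)
    rw [← sub_mul, abs_mul, abs_of_nonneg (Prob.nonneg μ s)]
  refine h1.trans ?_
  rw [Finset.sum_comm]
  have h2 : ∀ s, ∑ y, |k s y - k' s y| * μ s ≤ M * μ s := fun s => by
    rw [← Finset.sum_mul]
    exact mul_le_mul_of_nonneg_right (hk s) (Prob.nonneg μ s)
  refine (Finset.sum_le_sum fun s _ => h2 s).trans ?_
  rw [← Finset.mul_sum, Prob.sum_eq_one, mul_one]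

end Simplex

/-! ### Minimizers of regularized linear costs. -/

section BestResponse

variable {A : Type*} [Fintype A] {ρ : ℝ} {Ω : (A → ℝ) → ℝ}

/-- The regularized linear cost `⟨q, u⟩ + Ω(u)`. -/
def regCost (Ω : (A → ℝ) → ℝ) (q : A → ℝ) (u : Prob A) : ℝ := ∑ a, q a * u a + Ω u

lemma continuous_coord (a : A) : Continuous fun u : Prob A => u a :=
  (continuous_apply a).comp continuous_subtype_val

lemma IsRegularizer.continuous (hΩ : IsRegularizer ρ Ω) : Continuous fun u : Prob A => Ω u :=
  continuousOn_iff_continuous_domRestrict.1 hΩ.continuousOn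

lemma IsRegularizer.continuous_regCost (hΩ : IsRegularizer ρ Ω) (q : A → ℝ) :
    Continuous (regCost Ω q) :=
  (continuous_finsetSum _ fun a _ => continuous_const.mul (continuous_coord a)).add hΩ.continuous

variable [Nonempty A]

lemma IsRegularizer.exists_argmin (hΩ : IsRegularizer ρ Ω) (q : A → ℝ) :
    ∃ u : Prob A, ∀ v, regCost Ω q u ≤ regCost Ω q v := by
  classical
  have : Nonempty (Prob A) := ⟨⟨_, single_mem_stdSimplex ℝ (Classical.arbitrary A)⟩⟩
  obtain ⟨u, -, hu⟩ := isCompact_univ.exists_isMinOn Set.univ_nonempty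
    (hΩ.continuous_regCost q).continuousOn
  exact ⟨u, fun v => hu (Set.mem_univ v)⟩

/-- The minimizer of `⟨q, u⟩ + Ω(u)`. -/
def bestResponse (Ω : (A → ℝ) → ℝ) (q : A → ℝ) : Prob A :=
  haveI : Nonempty (Prob A) := by
    classical exact ⟨⟨_, single_mem_stdSimplex ℝ (Classical.arbitrary A)⟩⟩
  Classical.epsilon fun u : Prob A => ∀ v, regCost Ω q u ≤ regCost Ω q v

/-- The minimum of `⟨q, u⟩ + Ω(u)`. -/
def minCost (Ω : (A → ℝ) → ℝ) (q : A → ℝ) : ℝ := regCost Ω q (bestResponse Ω q)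

lemma IsRegularizer.minCost_le (hΩ : IsRegularizer ρ Ω) (q : A → ℝ) (v : Prob A) :
    minCost Ω q ≤ regCost Ω q v :=
  Classical.epsilon_spec (hΩ.exists_argmin q) v

/-- Quadratic growth at the minimizer: compare it with `(1 - t) u + t v`, divide by `t` and let `t →
0`. -/
lemma IsRegularizer.minCost_add_le (hΩ : IsRegularizer ρ Ω) (q : A → ℝ) (v : Prob A) :
    minCost Ω q + ρ / 2 * l1 (bestResponse Ω q) v ^ 2 ≤ regCost Ω q v := by
  set u := bestResponse Ω q with hu
  have key : ∀ t ∈ Set.Ioo (0 : ℝ) 1,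
      minCost Ω q + (1 - t) * (ρ / 2 * l1 u v ^ 2) ≤ regCost Ω q v := by
    rintro t ⟨h0, h1⟩
    have hm := hΩ.minCost_le q ⟨(1 - t) • (u : A → ℝ) + t • (v : A → ℝ),
      (convex_stdSimplex ℝ A) u.2 v.2 (by linarith) h0.le (by ring)⟩
    have hs := hΩ.stronglyConvex u u.2 v v.2 (1 - t) t (by linarith) h0.le (by ring)
    have hl : regCost Ω q ⟨(1 - t) • (u : A → ℝ) + t • (v : A → ℝ),
      (convex_stdSimplex ℝ A) u.2 v.2 (by linarith) h0.le (by ring)⟩ =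
        (1 - t) * ∑ a, q a * u a + t * ∑ a, q a * v a
          + Ω ((1 - t) • (u : A → ℝ) + t • (v : A → ℝ)) := by
      simp only [regCost, Finset.mul_sum, ← Finset.sum_add_distrib]
      congr 1
      refine Finset.sum_congr rfl fun a _ => ?_
      change q a * ((1 - t) * u a + t * v a) = _
      ring
    have hmu : minCost Ω q = ∑ a, q a * u a + Ω u := rfl
    have hv : regCost Ω q v = ∑ a, q a * v a + Ω v := rfl
    have hl1 : ∑ a, |u a - v a| = l1 u v := rfl
    change Ω _ ≤ (1 - t) * Ω u + t * Ω v - _ at hs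
    rw [hl1] at hs
    have : 0 ≤ t * (regCost Ω q v - (minCost Ω q + (1 - t) * (ρ / 2 * l1 u v ^ 2))) := by
      rw [hv]
      nlinarith
    linarith [nonneg_of_mul_nonneg_right this h0]
  have hlim : Tendsto (fun t : ℝ => minCost Ω q + (1 - t) * (ρ / 2 * l1 u v ^ 2))
      (nhdsWithin 0 (Set.Ioi 0)) (nhds (minCost Ω q + (1 - 0) * (ρ / 2 * l1 u v ^ 2))) := by
    have : Continuous fun t : ℝ => minCost Ω q + (1 - t) * (ρ / 2 * l1 u v ^ 2) := by fun_prop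
    exact (this.tendsto 0).mono_left nhdsWithin_le_nhds
  have := le_of_tendsto hlim (Filter.eventually_of_mem (Ioo_mem_nhdsGT one_pos) key)
  linarith

lemma IsRegularizer.eq_bestResponse (hΩ : IsRegularizer ρ Ω) {q : A → ℝ} {v : Prob A}
    (h : regCost Ω q v ≤ minCost Ω q) : v = bestResponse Ω q := by
  have h1 := hΩ.minCost_add_le q v
  have hρ := hΩ.pos
  have h2 : l1 (bestResponse Ω q) v ^ 2 ≤ 0 := by
    by_contra hc
    push Not at hc
    have : 0 < ρ / 2 * l1 (bestResponse Ω q) v ^ 2 := by positivity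
    linarith
  have h3 : l1 (bestResponse Ω q) v = 0 := by
    exact pow_eq_zero_iff two_ne_zero |>.1 (le_antisymm h2 (sq_nonneg _))
  rw [l1, Finset.sum_eq_zero_iff_of_nonneg fun _ _ => abs_nonneg _] at h3
  refine Subtype.ext (funext fun a => ?_)
  have := abs_eq_zero.1 (h3 a (Finset.mem_univ a))
  change v a = bestResponse Ω q a
  linarith

lemma IsRegularizer.abs_minCost_sub_le (hΩ : IsRegularizer ρ Ω) {q q' : A → ℝ} {M : ℝ}
    (h : ∀ a, |q a - q' a| ≤ M) : |minCost Ω q - minCost Ω q'| ≤ M := by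
  have key : ∀ q q' : A → ℝ, (∀ a, |q a - q' a| ≤ M) → minCost Ω q ≤ minCost Ω q' + M := by
    intro q q' h
    have h1 := hΩ.minCost_le q (bestResponse Ω q')
    have h2 := Prob.abs_sum_mul_le _ M h (bestResponse Ω q')
    have h3 : regCost Ω q (bestResponse Ω q') - minCost Ω q'
        = ∑ a, (q a - q' a) * bestResponse Ω q' a := by
      simp only [minCost, regCost, sub_mul, Finset.sum_sub_distrib]; ring
    have := (abs_le.1 h2).2
    linarith
  have h1 := key q q' h
  have h2 := key q' q fun a => by rw [abs_sub_comm]; exact h a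
  rw [abs_le]; constructor <;> linarith

/-- Evaluate each quadratic growth bound at the other minimizer and add: `ρ ‖u - v‖² ≤ ⟨q - q', v -
u⟩ ≤ M ‖u - v‖`. -/
lemma IsRegularizer.l1_bestResponse_le (hΩ : IsRegularizer ρ Ω) {q q' : A → ℝ} {M : ℝ}
    (h : ∀ a, |q a - q' a| ≤ M) : l1 (bestResponse Ω q) (bestResponse Ω q') ≤ M / ρ := by
  set u := bestResponse Ω q
  set v := bestResponse Ω q'
  have h1 : minCost Ω q + ρ / 2 * l1 u v ^ 2 ≤ regCost Ω q v := hΩ.minCost_add_le q v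
  have h2 : minCost Ω q' + ρ / 2 * l1 v u ^ 2 ≤ regCost Ω q' u := hΩ.minCost_add_le q' u
  rw [l1_comm v u] at h2
  have h3 : (regCost Ω q v - minCost Ω q) + (regCost Ω q' u - minCost Ω q')
      = ∑ a, (q a - q' a) * (v a - u a) := by
    simp only [minCost, regCost, sub_mul, mul_sub, Finset.sum_sub_distrib]; ring
  have h4 := abs_sum_mul_le _ M h (fun a => v a - u a)
  have h5 : ∑ a, |v a - u a| = l1 u v := l1_comm _ _
  rw [h5] at h4
  have h6 := (abs_le.1 h4).2
  have hρ := hΩ.pos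
  have hM : 0 ≤ M := (abs_nonneg _).trans (h (Classical.arbitrary A))
  rw [le_div_iff₀ hρ]
  rcases (l1_nonneg u v).eq_or_lt with h0 | h0
  · rw [← h0]; linarith
  · have : l1 u v * (l1 u v * ρ) ≤ l1 u v * M := by nlinarith
    exact le_of_mul_le_mul_left this h0

end BestResponse

/-! ### The coupled forward-backward recursion. -/

/-- If the errors `δ` propagate forwards and the errors `r` backwards, both are small far from the
two ends of the horizon. -/
lemma exists_interior_decay {a b c β : ℝ} (ha : 0 ≤ a) (hb : 0 ≤ b) (hc : 0 ≤ c) (hβ : 0 ≤ β)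
    (hβ1 : β < 1) (h : a + b * c / (1 - β) < 1) (D R : ℝ) :
    ∃ θ B κ : ℝ, 0 ≤ θ ∧ θ < 1 ∧ 0 < κ ∧ ∀ (T : ℕ) (δ r : ℕ → ℝ), (∀ t ≤ T, δ t ≤ D) →
      (∀ t ≤ T, r t ≤ R) → (∀ t < T, δ (t + 1) ≤ a * δ t + b * r t) →
      (∀ t < T, r t ≤ c * δ t + β * r (t + 1)) →
      ∀ k t, k ≤ t → t + k ≤ T → δ t ≤ B * θ ^ k ∧ κ * r t ≤ B * θ ^ k := by
  have h1 : 0 < 1 - β := by linarith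
  have hbc : 0 ≤ b * c / (1 - β) := by positivity
  have ha1 : 0 < 1 - a := by linarith
  have hs : 0 < (1 - a) * (1 - β) - b * c := by
    have : b * c / (1 - β) < 1 - a := by linarith
    rw [div_lt_iff₀ h1] at this
    linarith
  -- The weight `κ` must satisfy `b < κ (1 - a)` and `κ c < 1 - β`. The hypothesis leaves a gap, of
  -- which `s` takes a small part; `c + 1` covers `c = 0`.
  set s := ((1 - a) * (1 - β) - b * c) / (2 * (c + 1)) with hsdef
  have hspos : 0 < s := by positivity
  have hsc : s * c < (1 - a) * (1 - β) - b * c := by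
    have : s * (2 * (c + 1)) = (1 - a) * (1 - β) - b * c := by
      rw [hsdef]; field_simp
    nlinarith
  set κ := (b + s) / (1 - a) with hκdef
  have hκ : 0 < κ := by positivity
  have hκa : κ * (1 - a) = b + s := by rw [hκdef]; field_simp
  have hκc : κ * c + β < 1 := by
    have : (1 - a) * (κ * c) < (1 - a) * (1 - β) := by nlinarith
    have := lt_of_mul_lt_mul_left this ha1.le
    linarith
  have hκb : a + b / κ < 1 := by
    have : b / κ < 1 - a := by rw [div_lt_iff₀ hκ]; nlinarith
    linarith
  set θ := max (a + b / κ) (κ * c + β) with hθdef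
  have hθ0 : 0 ≤ θ := le_max_of_le_left (by positivity)
  have hθ1 : θ < 1 := max_lt hκb hκc
  set B := max 0 (max D (κ * R)) with hBdef
  have hB0 : 0 ≤ B := le_max_left _ _
  refine ⟨θ, B, κ, hθ0, hθ1, hκ, fun T δ r hδ hr hδr hrδ k => ?_⟩
  -- Here `k` bounds from below the distance to both ends. Each step gains a factor `θ`, using time
  -- `t - 1` for `δ` and time `t + 1` for `r`.
  induction k with
  | zero =>
    intro t _ ht
    rw [pow_zero, mul_one]
    refine ⟨(hδ t ht).trans ((le_max_left _ _).trans (le_max_right _ _)), ?_⟩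
    exact (mul_le_mul_of_nonneg_left (hr t ht) hκ.le).trans
      ((le_max_right _ _).trans (le_max_right _ _))
  | succ k ih =>
    intro t hkt htT
    have hBk : 0 ≤ B * θ ^ k := by positivity
    obtain ⟨i1, i2⟩ := ih (t - 1) (by omega) (by omega)
    obtain ⟨i3, i4⟩ := ih t (by omega) (by omega)
    obtain ⟨i5, i6⟩ := ih (t + 1) (by omega) (by omega)
    constructor
    · have e := hδr (t - 1) (by omega)
      rw [Nat.sub_add_cancel (by omega)] at e
      have i2' : r (t - 1) ≤ B * θ ^ k / κ := by rw [le_div_iff₀ hκ]; linarith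
      calc δ t ≤ a * (B * θ ^ k) + b * (B * θ ^ k / κ) := e.trans (by gcongr)
        _ = (a + b / κ) * (B * θ ^ k) := by ring
        _ ≤ θ * (B * θ ^ k) := mul_le_mul_of_nonneg_right (le_max_left _ _) hBk
        _ = B * θ ^ (k + 1) := by ring
    · have e := hrδ t (by omega)
      calc κ * r t ≤ κ * (c * δ t + β * r (t + 1)) := mul_le_mul_of_nonneg_left e hκ.le
        _ = κ * c * δ t + β * (κ * r (t + 1)) := by ring
        _ ≤ κ * c * (B * θ ^ k) + β * (B * θ ^ k) := by gcongr
        _ = (κ * c + β) * (B * θ ^ k) := by ring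
        _ ≤ θ * (B * θ ^ k) := mul_le_mul_of_nonneg_right (le_max_right _ _) hBk
        _ = B * θ ^ (k + 1) := by ring

/-! ### Dynamic programming and optimality of equilibrium policies. -/

section Optimality

variable {X A : Type*} [Fintype X] [Fintype A]

/-- The state-action cost with continuation value `J`. -/
def Game.actionCost (G : Game X A) (β : ℝ) (m : Prob X) (J : X → ℝ) (x : X) (a : A) : ℝ :=
  G.cost x a m + β * ∑ y, J y * G.trans x a m y

/-- Cost and transition are linear in `u`, so the Bellman objective is a regularized linear cost and
the best-response estimates apply state by state. -/
lemma Game.regCost_actionCost (G : Game X A) (Ω : (A → ℝ) → ℝ) (β : ℝ) (m : Prob X) (J : X → ℝ)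
    (x : X) (u : Prob A) : regCost Ω (G.actionCost β m J x) u
      = (G.liftCost x u m + Ω u) + β * ∑ y, J y * G.liftTrans x u m y := by
  have : ∑ y, J y * G.liftTrans x u m y = ∑ a, (∑ y, J y * G.trans x a m y) * u a := by
    simp only [Game.liftTrans, Finset.mul_sum, Finset.sum_mul, mul_assoc]
    exact Finset.sum_comm
  rw [this, regCost, Game.liftCost]
  simp only [Game.actionCost, add_mul, Finset.sum_add_distrib, mul_assoc β, ← Finset.mul_sum]
  ring

lemma Game.liftTrans_nonneg (G : Game X A) (x : X) (u : Prob A) (m : Prob X) (y : X) :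
    0 ≤ G.liftTrans x u m y :=
  Finset.sum_nonneg fun _ _ => mul_nonneg (Prob.nonneg _ _) (Prob.nonneg _ _)

lemma Game.sum_liftTrans (G : Game X A) (x : X) (u : Prob A) (m : Prob X) :
    ∑ y, G.liftTrans x u m y = 1 := by
  simp only [Game.liftTrans]
  rw [Finset.sum_comm]
  simp only [← Finset.sum_mul, Prob.sum_eq_one, one_mul]

lemma Game.continuous_liftTrans (G : Game X A) (x : X) (m : Prob X) (y : X) :
    Continuous fun u : Prob A => G.liftTrans x u m y :=
  continuous_finsetSum _ fun a _ => continuous_const.mul (continuous_coord a)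

lemma Game.continuous_liftCost (G : Game X A) (x : X) (m : Prob X) :
    Continuous fun u : Prob A => G.liftCost x u m :=
  continuous_finsetSum _ fun a _ => continuous_const.mul (continuous_coord a)

lemma exists_abs_le_of_continuous {g : X × Prob A → ℝ}
    (hg : ∀ x, Continuous fun u => g (x, u)) : ∃ M, ∀ z, |g z| ≤ M := by
  have h : ∀ x, ∃ M, ∀ u, |g (x, u)| ≤ M := fun x => by
    obtain ⟨M, hM⟩ := isCompact_univ.exists_bound_of_continuousOn (hg x).continuousOn
    exact ⟨M, fun u => hM u (Set.mem_univ u)⟩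
  choose M hM using h
  refine ⟨∑ x, |M x|, fun ⟨x, u⟩ => ((hM x u).trans (le_abs_self _)).trans ?_⟩
  exact Finset.single_le_sum (f := fun x => |M x|) (fun _ _ => abs_nonneg _) (Finset.mem_univ x)

lemma integrable_of_continuous {P : Measure (Prob A)} [IsFiniteMeasure P] {g : Prob A → ℝ}
    (hg : Continuous g) : Integrable g P := by
  obtain ⟨M, hM⟩ := isCompact_univ.exists_bound_of_continuousOn hg.continuousOn
  exact Integrable.of_bound hg.aestronglyMeasurable M (ae_of_all _ fun u => hM u (Set.mem_univ u))

variable [MeasurableSpace X]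

instance (μ : Prob X) : IsProbabilityMeasure (toMeasure μ) where
  measure_univ := by
    simp only [toMeasure, Measure.coe_finsetSum, Finset.sum_apply, Measure.smul_apply,
      measure_univ, smul_eq_mul, mul_one]
    rw [← ENNReal.ofReal_sum_of_nonneg fun _ _ => Prob.nonneg _ _, Prob.sum_eq_one,
      ENNReal.ofReal_one]

variable [MeasurableSingletonClass X]

lemma integral_toMeasure (μ : Prob X) (g : X → ℝ) :
    ∫ x, g x ∂toMeasure μ = ∑ x, μ x * g x := by
  rw [toMeasure, integral_finsetSum_measure fun x _ => ?_]
  · refine Finset.sum_congr rfl fun x _ => ?_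
    rw [integral_smul_measure, integral_dirac, ENNReal.toReal_ofReal (Prob.nonneg _ _),
      smul_eq_mul]
  · exact (integrable_dirac (by simp)).smul_measure ENNReal.ofReal_ne_top

lemma integral_joint (π : Policy X A) [IsMarkovKernel π] (ν : Prob X) {g : X × Prob A → ℝ}
    (hg : ∀ x, Continuous fun u => g (x, u)) :
    ∫ z, g z ∂joint π ν = ∑ x, ν x * ∫ u, g (x, u) ∂π x := by
  have hm : Measurable g := measurable_from_prod_countable_right fun x => (hg x).measurable
  obtain ⟨M, hM⟩ := exists_abs_le_of_continuous hg
  rw [joint, Measure.integral_compProd (Integrable.of_bound hm.aestronglyMeasurable M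
    (ae_of_all _ hM)), integral_toMeasure]

/-- The next state law of a player, as a point of the simplex. -/
lemma Game.exists_nextProb (G : Game X A) (m : Prob X) (π : Policy X A) [IsMarkovKernel π]
    (ν : Prob X) : ∃ ν' : Prob X, ∀ y, ν' y = ∫ z, G.liftTrans z.1 z.2 m y ∂joint π ν := by
  refine ⟨⟨fun y => ∫ z, G.liftTrans z.1 z.2 m y ∂joint π ν, fun y =>
    integral_nonneg fun z => G.liftTrans_nonneg _ _ _ _, ?_⟩, fun y => rfl⟩
  have h : ∀ y, ∫ z, G.liftTrans z.1 z.2 m y ∂joint π ν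
      = ∑ x, ν x * ∫ u, G.liftTrans x u m y ∂π x := fun y =>
    integral_joint π ν (g := fun z => G.liftTrans z.1 z.2 m y)
      fun x => G.continuous_liftTrans x m y
  simp only [h]
  rw [Finset.sum_comm]
  simp only [← Finset.mul_sum]
  have h2 : ∀ x, ∑ y, ∫ u, G.liftTrans x u m y ∂π x = 1 := fun x => by
    rw [← integral_finsetSum _ fun y _ => integrable_of_continuous (G.continuous_liftTrans x m y)]
    simp [G.sum_liftTrans]
  simp only [h2, mul_one, Prob.sum_eq_one]

lemma Game.exists_stateLaw (G : Game X A) (ν₀ : Prob X) (μ : ℕ → Prob X) (π : ℕ → Policy X A)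
    (hπ : ∀ t, IsMarkovKernel (π t)) :
    ∃ ν : ℕ → Prob X, ν 0 = ν₀ ∧
      (∀ t y, ν (t + 1) y = ∫ z, G.liftTrans z.1 z.2 (μ t) y ∂joint (π t) (ν t)) ∧
      ∀ t, G.stateLaw ν₀ μ π t = toMeasure (ν t) := by
  choose F hF using fun (t : ℕ) (ν : Prob X) => G.exists_nextProb (μ t) (π t) ν
  let ν : ℕ → Prob X := fun t => Nat.rec ν₀ F t
  have hν : ∀ t y, ν (t + 1) y = ∫ z, G.liftTrans z.1 z.2 (μ t) y ∂joint (π t) (ν t) :=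
    fun t y => hF t (ν t) y
  refine ⟨ν, rfl, hν, fun t => ?_⟩
  induction t with
  | zero => rfl
  | succ t ih =>
    simp only [Game.stateLaw, Game.nextLaw, ih]
    exact Finset.sum_congr rfl fun y _ => by rw [hν t y, joint]

variable [Nonempty A] {ρ : ℝ} {Ω : (A → ℝ) → ℝ}

/-- The expected excess of the one-step policy `π` over the optimal action. -/
def Game.excess (G : Game X A) (Ω : (A → ℝ) → ℝ) (β : ℝ) (m : Prob X) (J : X → ℝ)
    (π : Policy X A) (ν : Prob X) : ℝ :=
  ∑ x, ν x * ∫ u, (regCost Ω (G.actionCost β m J x) u - minCost Ω (G.actionCost β m J x)) ∂π x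

/-- The policy that plays the best response to the continuation value `J`. -/
def Game.greedy (G : Game X A) (Ω : (A → ℝ) → ℝ) (β : ℝ) (m : Prob X) (J : X → ℝ) : Policy X A :=
  Kernel.deterministic (fun x => bestResponse Ω (G.actionCost β m J x)) (measurable_of_countable _)

instance (G : Game X A) (β : ℝ) (m : Prob X) (J : X → ℝ) : IsMarkovKernel (G.greedy Ω β m J) := by
  unfold Game.greedy; infer_instance

lemma Game.greedy_ae (G : Game X A) (β : ℝ) (m : Prob X) (J : X → ℝ) (x : X) :
    ∀ᵐ u ∂G.greedy Ω β m J x, u = bestResponse Ω (G.actionCost β m J x) := by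
  rw [Game.greedy, Kernel.deterministic_apply, ae_dirac_eq]
  rfl

omit [MeasurableSingletonClass X] in
lemma Game.excess_nonneg (G : Game X A) (hΩ : IsRegularizer ρ Ω) (β : ℝ) (m : Prob X) (J : X → ℝ)
    (π : Policy X A) (ν : Prob X) : 0 ≤ G.excess Ω β m J π ν :=
  Finset.sum_nonneg fun _ _ => mul_nonneg (Prob.nonneg _ _) <|
    integral_nonneg fun u => sub_nonneg.2 (hΩ.minCost_le _ u)

lemma Game.excess_greedy (G : Game X A) (β : ℝ) (m : Prob X) (J : X → ℝ) (ν : Prob X) :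
    G.excess Ω β m J (G.greedy Ω β m J) ν = 0 := by
  refine Finset.sum_eq_zero fun x _ => mul_eq_zero_of_right _ ?_
  refine integral_eq_zero_of_ae ?_
  filter_upwards [G.greedy_ae β m J x] with u hu
  simp [hu, minCost]

-- A nonnegative integrand with zero integral vanishes almost everywhere. States of zero mass do not
-- contribute to the excess, so nothing is learnt there.
omit [MeasurableSingletonClass X] in
lemma Game.ae_eq_of_excess_nonpos (G : Game X A) (hΩ : IsRegularizer ρ Ω) {β : ℝ} {m : Prob X}
    {J : X → ℝ} {π : Policy X A} [IsMarkovKernel π] {ν : Prob X}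
    (h : G.excess Ω β m J π ν ≤ 0) (x : X) (hx : ν x ≠ 0) :
    ∀ᵐ u ∂π x, u = bestResponse Ω (G.actionCost β m J x) := by
  have h0 := le_antisymm h (G.excess_nonneg hΩ β m J π ν)
  have hn : ∀ x, 0 ≤ fun u => regCost Ω (G.actionCost β m J x) u
      - minCost Ω (G.actionCost β m J x) := fun x u => sub_nonneg.2 (hΩ.minCost_le _ u)
  rw [Game.excess, Finset.sum_eq_zero_iff_of_nonneg fun x _ =>
    mul_nonneg (Prob.nonneg _ _) (integral_nonneg (hn x))] at h0
  have h1 := (mul_eq_zero.1 (h0 x (Finset.mem_univ x))).resolve_left hx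
  rw [integral_eq_zero_iff_of_nonneg (hn x) (integrable_of_continuous
    ((hΩ.continuous_regCost _).sub continuous_const))] at h1
  filter_upwards [h1] with u hu
  exact hΩ.eq_bestResponse (sub_nonpos.1 (le_of_eq hu))

/-- The one-step identity that telescopes into the performance difference formula. -/
lemma Game.stage_eq (G : Game X A) (hΩ : IsRegularizer ρ Ω) (β : ℝ) (m : Prob X) (J : X → ℝ)
    (π : Policy X A) [IsMarkovKernel π] {ν ν' : Prob X}
    (hν : ∀ y, ν' y = ∫ z, G.liftTrans z.1 z.2 m y ∂joint π ν) :
    ∫ z, (G.liftCost z.1 z.2 m + Ω z.2) ∂joint π ν + β * ∑ y, J y * ν' y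
      = ∑ x, minCost Ω (G.actionCost β m J x) * ν x + G.excess Ω β m J π ν := by
  have h1 : ∀ y, ν' y = ∑ x, ν x * ∫ u, G.liftTrans x u m y ∂π x := fun y => (hν y).trans <|
    integral_joint π ν (g := fun z => G.liftTrans z.1 z.2 m y)
      fun x => G.continuous_liftTrans x m y
  have hc : ∀ x, Continuous fun u : Prob A => G.liftCost x u m + Ω u := fun x =>
    (G.continuous_liftCost x m).add hΩ.continuous
  have h2 : ∫ z, (G.liftCost z.1 z.2 m + Ω z.2) ∂joint π ν
      = ∑ x, ν x * ∫ u, (G.liftCost x u m + Ω u) ∂π x :=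
    integral_joint π ν (g := fun z => G.liftCost z.1 z.2 m + Ω z.2) hc
  have h3 : ∀ x, ∫ u, (regCost Ω (G.actionCost β m J x) u - minCost Ω (G.actionCost β m J x)) ∂π x
      = ∫ u, (G.liftCost x u m + Ω u) ∂π x
        + β * ∑ y, J y * ∫ u, G.liftTrans x u m y ∂π x - minCost Ω (G.actionCost β m J x) := by
    intro x
    rw [integral_sub (integrable_of_continuous (hΩ.continuous_regCost _)) (integrable_const _)]
    simp only [G.regCost_actionCost]
    rw [integral_add (integrable_of_continuous (hc x))]
    · rw [integral_const_mul, integral_finsetSum]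
      · simp [integral_const_mul]
      · exact fun y _ => (integrable_of_continuous (G.continuous_liftTrans x m y)).const_mul _
    · exact (integrable_finsetSum _ fun y _ =>
        (integrable_of_continuous (G.continuous_liftTrans x m y)).const_mul _).const_mul _
  have h4 : ∑ y, J y * ν' y = ∑ x, ν x * ∑ y, J y * ∫ u, G.liftTrans x u m y ∂π x := by
    simp only [h1, Finset.mul_sum]
    rw [Finset.sum_comm]
    exact Finset.sum_congr rfl fun x _ => Finset.sum_congr rfl fun y _ => by ring
  rw [h2, h4, Game.excess, Finset.mul_sum, ← Finset.sum_add_distrib, ← Finset.sum_add_distrib]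
  refine Finset.sum_congr rfl fun x _ => ?_
  rw [h3]
  ring

/-- The performance difference formula. -/
lemma Game.sum_stageCost (G : Game X A) (hΩ : IsRegularizer ρ Ω) (β : ℝ) {ν₀ : Prob X}
    {μ : ℕ → Prob X} {π : ℕ → Policy X A} (hπ : ∀ t, IsMarkovKernel (π t)) {ν : ℕ → Prob X}
    (hν : ∀ t y, ν (t + 1) y = ∫ z, G.liftTrans z.1 z.2 (μ t) y ∂joint (π t) (ν t))
    (hs : ∀ t, G.stateLaw ν₀ μ π t = toMeasure (ν t)) (J : ℕ → X → ℝ) (n : ℕ)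
    (hJ : ∀ t < n, ∀ x, J t x = minCost Ω (G.actionCost β (μ t) (J (t + 1)) x)) :
    ∑ t ∈ Finset.range n, β ^ t * G.stageCost Ω ν₀ μ π t
      = ∑ x, J 0 x * ν 0 x - β ^ n * ∑ x, J n x * ν n x
        + ∑ t ∈ Finset.range n, β ^ t * G.excess Ω β (μ t) (J (t + 1)) (π t) (ν t) := by
  induction n with
  | zero => simp
  | succ n ih =>
    rw [Finset.sum_range_succ, Finset.sum_range_succ, ih fun t ht => hJ t (by omega)]
    have h := G.stage_eq hΩ β (μ n) (J (n + 1)) (π n) (hν n)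
    simp only [← hJ n n.lt_succ_self] at h
    have h2 : G.stageCost Ω ν₀ μ π n
        = ∫ z, (G.liftCost z.1 z.2 (μ n) + Ω z.2) ∂joint (π n) (ν n) := by
      rw [Game.stageCost, hs, joint]
    rw [h2, eq_sub_of_add_eq h, pow_succ]
    ring

/-- The optimal value with `n` remaining decisions from time `t` on. -/
def Game.valueToGo (G : Game X A) (Ω : (A → ℝ) → ℝ) (β : ℝ) (μ : ℕ → Prob X) :
    ℕ → ℕ → X → ℝ
  | 0, _ => 0
  | n + 1, t => fun x => minCost Ω (G.actionCost β (μ t) (Game.valueToGo G Ω β μ n (t + 1)) x)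

omit [MeasurableSpace X] [MeasurableSingletonClass X] in
lemma Game.valueToGo_sub (G : Game X A) (β : ℝ) (μ : ℕ → Prob X) {T t : ℕ} (ht : t < T) (x : X) :
    G.valueToGo Ω β μ (T - t) t x
      = minCost Ω (G.actionCost β (μ t) (G.valueToGo Ω β μ (T - (t + 1)) (t + 1)) x) := by
  obtain ⟨n, rfl⟩ : ∃ n, T = t + 1 + n := ⟨T - (t + 1), by omega⟩
  rw [show t + 1 + n - t = n + 1 by omega, show t + 1 + n - (t + 1) = n by omega]
  rfl

lemma Game.finiteCost_eq (G : Game X A) (hΩ : IsRegularizer ρ Ω) (β : ℝ) {ν₀ : Prob X}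
    {μ : ℕ → Prob X} {π : ℕ → Policy X A} (hπ : ∀ t, IsMarkovKernel (π t)) {ν : ℕ → Prob X}
    (hν : ∀ t y, ν (t + 1) y = ∫ z, G.liftTrans z.1 z.2 (μ t) y ∂joint (π t) (ν t))
    (hs : ∀ t, G.stateLaw ν₀ μ π t = toMeasure (ν t)) (T : ℕ) :
    G.finiteCost Ω β T ν₀ μ π = ∑ x, G.valueToGo Ω β μ (T + 1) 0 x * ν 0 x
        + ∑ t ∈ Finset.range (T + 1), β ^ t * G.excess Ω β (μ t)
          (G.valueToGo Ω β μ (T + 1 - (t + 1)) (t + 1)) (π t) (ν t) := by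
  -- Times `0, …, T` carry `T + 1` decisions; the value at time `T + 1` is zero, so the boundary
  -- term drops out.
  rw [Game.finiteCost, G.sum_stageCost hΩ β hπ hν hs (fun t => G.valueToGo Ω β μ (T + 1 - t) t)
    (T + 1) fun t ht x => G.valueToGo_sub β μ ht x]
  simp [Game.valueToGo]

/-- The greedy competitor has zero excess, so optimality makes the discounted sum of excesses
nonpositive. Positivity of `β ^ t` is what forces each term to vanish. -/
lemma Game.IsFiniteMFE.ae_eq {G : Game X A} {β : ℝ} {μ₀ : Prob X} {T : ℕ} {π : ℕ → Policy X A}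
    {μ : ℕ → Prob X} (h : G.IsFiniteMFE Ω β μ₀ T π μ) (hΩ : IsRegularizer ρ Ω) (hβ : 0 < β)
    {t : ℕ} (ht : t ≤ T) (x : X) (hx : μ t x ≠ 0) :
    ∀ᵐ u ∂π t x, u = bestResponse Ω (G.actionCost β (μ t)
      (G.valueToGo Ω β μ (T + 1 - (t + 1)) (t + 1)) x) := by
  have := h.markov t
  obtain ⟨ν, hν0, hν, hs⟩ := G.exists_stateLaw μ₀ μ π h.markov
  have hμ : ∀ t ≤ T, ν t = μ t := by
    intro t
    induction t with
    | zero => intro _; rw [hν0, h.init]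
    | succ t ih =>
      intro ht
      refine Subtype.ext (funext fun y => ?_)
      have h1 := hν t y
      rw [ih (by omega), ← h.flow t (by omega)] at h1
      exact h1
  let π' : ℕ → Policy X A := fun t =>
    G.greedy Ω β (μ t) (G.valueToGo Ω β μ (T + 1 - (t + 1)) (t + 1))
  have hπ' : ∀ t, IsMarkovKernel (π' t) := fun t => inferInstance
  obtain ⟨ν', hν0', hν', hs'⟩ := G.exists_stateLaw μ₀ μ π' hπ'
  have hopt := h.optimal π' hπ'
  rw [G.finiteCost_eq hΩ β h.markov hν hs, G.finiteCost_eq hΩ β hπ' hν' hs', hν0, hν0'] at hopt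
  simp only [π', G.excess_greedy, mul_zero, Finset.sum_const_zero, add_zero] at hopt
  have h1 := Finset.single_le_sum (f := fun t => β ^ t * G.excess Ω β (μ t)
    (G.valueToGo Ω β μ (T + 1 - (t + 1)) (t + 1)) (π t) (ν t))
    (fun t _ => mul_nonneg (by positivity) (G.excess_nonneg hΩ _ _ _ _ _))
    (Finset.mem_range.2 (Nat.lt_succ_of_le ht))
  have h2 : β ^ t * G.excess Ω β (μ t)
    (G.valueToGo Ω β μ (T + 1 - (t + 1)) (t + 1)) (π t) (ν t) ≤ 0 := by linarith
  have h3 := nonpos_of_mul_nonpos_right h2 (by positivity)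
  rw [hμ t ht] at h3
  exact G.ae_eq_of_excess_nonpos hΩ h3 x hx

/-- Without discounting of the future into the present, greedy play is an equilibrium. -/
lemma Game.exists_greedy_isFiniteMFE (G : Game X A) (hΩ : IsRegularizer ρ Ω) (μ₀ : Prob X) :
    ∃ (π : ℕ → Policy X A) (μ : ℕ → Prob X), (∀ T, G.IsFiniteMFE Ω 0 μ₀ T π μ) ∧
      ∀ t x J, ∀ᵐ u ∂π t x, u = bestResponse Ω (G.actionCost 0 (μ t) J x) := by
  choose F hF using fun m : Prob X => G.exists_nextProb m (G.greedy Ω 0 m 0) m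
  let μ : ℕ → Prob X := fun t => Nat.rec μ₀ (fun _ => F) t
  -- At `β = 0` continuation values are invisible, so greedy for `J = 0` is greedy for every `J`.
  have hq : ∀ m J J' x, G.actionCost 0 m J x = G.actionCost 0 m J' x := fun m J J' x => by
    funext a; simp [Game.actionCost]
  have hg : ∀ t, IsMarkovKernel (G.greedy Ω 0 (μ t) 0) :=
    fun t => by infer_instance
  refine ⟨fun t => G.greedy Ω 0 (μ t) 0, μ, fun T => ⟨hg, rfl,
    fun t _ y => hF (μ t) y, fun π' hπ' => ?_⟩, fun t x J => ?_⟩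
  · obtain ⟨ν, hν0, hν, hs⟩ := G.exists_stateLaw μ₀ μ (fun t => G.greedy Ω 0 (μ t) 0) hg
    obtain ⟨ν', hν0', hν', hs'⟩ := G.exists_stateLaw μ₀ μ π' hπ'
    rw [G.finiteCost_eq hΩ 0 hg hν hs, G.finiteCost_eq hΩ 0 hπ' hν' hs',
      hν0, hν0']
    gcongr with t ht
    have : G.excess Ω 0 (μ t) (G.valueToGo Ω 0 μ (T + 1 - (t + 1)) (t + 1))
        (G.greedy Ω 0 (μ t) 0) (ν t) = 0 := by
      refine Eq.trans ?_ (G.excess_greedy (Ω := Ω) 0 (μ t) 0 (ν t))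
      simp only [Game.excess, hq (μ t) (G.valueToGo Ω 0 μ (T + 1 - (t + 1)) (t + 1)) 0]
    rw [this]
    exact G.excess_nonneg hΩ _ _ _ _ _
  · rw [hq _ J 0]
    exact G.greedy_ae 0 (μ t) 0 x

omit [Nonempty A] in
lemma Game.exists_abs_stageCost_le (G : Game X A) (hΩ : IsRegularizer ρ Ω) (ν₀ m : Prob X)
    {π : ℕ → Policy X A} (hπ : ∀ t, IsMarkovKernel (π t)) :
    ∃ M, ∀ t, |G.stageCost Ω ν₀ (fun _ => m) π t| ≤ M := by
  obtain ⟨ν, -, -, hs⟩ := G.exists_stateLaw ν₀ (fun _ => m) π hπ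
  obtain ⟨M, hM⟩ := exists_abs_le_of_continuous
    (g := fun z : X × Prob A => G.liftCost z.1 z.2 m + Ω z.2) fun x =>
      (G.continuous_liftCost x m).add hΩ.continuous
  refine ⟨M, fun t => ?_⟩
  have := hπ t
  rw [Game.stageCost, hs]
  have h := norm_integral_le_of_norm_le_const (μ := toMeasure (ν t) ⊗ₘ π t)
    (f := fun z : X × Prob A => G.liftCost z.1 z.2 m + Ω z.2) (ae_of_all _ hM)
  simpa using h

omit [Nonempty A] in
lemma Game.tendsto_infiniteCost (G : Game X A) (hΩ : IsRegularizer ρ Ω) {β : ℝ} (hβ0 : 0 ≤ β)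
    (hβ1 : β < 1) (ν₀ m : Prob X) {π : ℕ → Policy X A} (hπ : ∀ t, IsMarkovKernel (π t)) :
    Tendsto (fun n => ∑ t ∈ Finset.range n, β ^ t * G.stageCost Ω ν₀ (fun _ => m) π t) atTop
      (nhds (G.infiniteCost Ω β ν₀ (fun _ => m) π)) := by
  obtain ⟨M, hM⟩ := G.exists_abs_stageCost_le hΩ ν₀ m hπ
  refine (Summable.hasSum ?_).tendsto_sum_nat
  refine Summable.of_norm_bounded (g := fun t => β ^ t * M)
    ((summable_geometric_of_lt_one hβ0 hβ1).mul_right M) fun t => ?_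
  rw [norm_mul, Real.norm_of_nonneg (pow_nonneg hβ0 t)]
  exact mul_le_mul_of_nonneg_left (hM t) (pow_nonneg hβ0 t)

/-- The performance difference formula with constant value `J`, in the limit where the remainder `β
^ n` vanishes. Only the excess at time `0` is kept; its weight is 1 even when `β = 0`. -/
lemma Game.IsStationaryMFE.ae_eq {G : Game X A} {β : ℝ} {π : Policy X A} {μ : Prob X}
    (h : G.IsStationaryMFE Ω β π μ) (hΩ : IsRegularizer ρ Ω) (hβ0 : 0 ≤ β) (hβ1 : β < 1)
    {J : X → ℝ} (hJ : ∀ x, J x = minCost Ω (G.actionCost β μ J x)) (x : X) (hx : μ x ≠ 0) :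
    ∀ᵐ u ∂π x, u = bestResponse Ω (G.actionCost β μ J x) := by
  have := h.markov
  obtain ⟨M, hM⟩ : ∃ M, ∀ x, |J x| ≤ M :=
    ⟨∑ x, |J x|, fun x => Finset.single_le_sum (f := fun x => |J x|) (fun _ _ => abs_nonneg _)
      (Finset.mem_univ x)⟩
  have hlim : ∀ ν : ℕ → Prob X, Tendsto (fun n => ∑ x, J x * μ x - β ^ n * ∑ x, J x * ν n x)
      atTop (nhds (∑ x, J x * μ x)) := by
    intro ν
    have h0 : Tendsto (fun n => β ^ n * ∑ x, J x * ν n x) atTop (nhds 0) := by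
      refine squeeze_zero_norm (a := fun n => β ^ n * M) (fun n => ?_) ?_
      · rw [norm_mul, Real.norm_of_nonneg (pow_nonneg hβ0 n)]
        exact mul_le_mul_of_nonneg_left (Prob.abs_sum_mul_le _ M hM _) (pow_nonneg hβ0 n)
      · simpa using (tendsto_pow_atTop_nhds_zero_of_lt_one hβ0 hβ1).mul_const M
    simpa using tendsto_const_nhds.sub h0
  obtain ⟨ν, hν0, hν, hs⟩ := G.exists_stateLaw μ (fun _ => μ) (fun _ => π) fun _ => h.markov
  obtain ⟨ν', hν0', hν', hs'⟩ := G.exists_stateLaw μ (fun _ => μ)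
    (fun _ => G.greedy Ω β μ J) fun _ => inferInstance
  have h1 : G.infiniteCost Ω β μ (fun _ => μ) (fun _ => G.greedy Ω β μ J) = ∑ x, J x * μ x := by
    refine tendsto_nhds_unique (G.tendsto_infiniteCost hΩ hβ0 hβ1 μ μ fun _ => inferInstance) ?_
    refine (hlim ν').congr fun n => ?_
    rw [G.sum_stageCost hΩ β (fun _ => inferInstance) hν' hs' (fun _ => J) n fun t _ => hJ, hν0']
    simp [G.excess_greedy]
  have h2 : ∑ x, J x * μ x + G.excess Ω β μ J π μ
      ≤ G.infiniteCost Ω β μ (fun _ => μ) (fun _ => π) := by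
    refine le_of_tendsto_of_tendsto ((hlim ν).add_const _)
      (G.tendsto_infiniteCost hΩ hβ0 hβ1 μ μ fun _ => h.markov) ?_
    filter_upwards [eventually_gt_atTop 0] with n hn
    rw [G.sum_stageCost hΩ β (fun _ => h.markov) hν hs (fun _ => J) n fun t _ => hJ, hν0]
    have := Finset.single_le_sum (f := fun t => β ^ t * G.excess Ω β μ J π (ν t))
      (fun t _ => mul_nonneg (pow_nonneg hβ0 t) (G.excess_nonneg hΩ _ _ _ _ _))
      (Finset.mem_range.2 hn)
    simp only [pow_zero, one_mul, hν0] at this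
    linarith
  have h3 := h.optimal (fun _ => G.greedy Ω β μ J) fun _ => inferInstance
  exact G.ae_eq_of_excess_nonpos hΩ (by linarith) x hx

end Optimality

/-! ### Lipschitz estimates for the population update and the Bellman operator. -/

section Turnpike

variable {X A : Type*} [Fintype X]

section Lipschitz

variable {G : Game X A} {L K : ℝ}

lemma tv_self (μ : Prob X) : tv μ μ = 0 := by simp [tv]

lemma Game.IsLipschitz.cost_state (h : G.IsLipschitz L K) (hL : 0 ≤ L) (x x' : X) (a : A)
    (m : Prob X) : |G.cost x a m - G.cost x' a m| ≤ L := by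
  have := h.1 x x' a a m m
  rw [tv_self] at this
  split_ifs at this <;> first | (norm_num at this; linarith) | simp_all

lemma Game.IsLipschitz.cost_measure (h : G.IsLipschitz L K) (x : X) (a : A)
    (m m' : Prob X) : |G.cost x a m - G.cost x a m'| ≤ L * l1 m m' := by
  simpa [two_mul_tv] using h.1 x x a a m m'

lemma Game.IsLipschitz.trans_state (h : G.IsLipschitz L K) (hK : 0 ≤ K) (x x' : X) (a : A)
    (m : Prob X) : l1 (G.trans x a m) (G.trans x' a m) ≤ K := by
  have := h.2 x x' a a m m
  rw [tv_self] at this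
  rw [← two_mul_tv]
  by_cases hx : x = x' <;> simp [hx] at this ⊢ <;> linarith

lemma Game.IsLipschitz.trans_action (h : G.IsLipschitz L K) (hK : 0 ≤ K) (x : X) (a a' : A)
    (m : Prob X) : l1 (G.trans x a m) (G.trans x a' m) ≤ 2 * K := by
  have := h.2 x x a a' m m
  rw [tv_self] at this
  rw [← two_mul_tv]
  by_cases ha : a = a' <;> simp [ha] at this ⊢ <;> linarith

lemma Game.IsLipschitz.trans_measure (h : G.IsLipschitz L K) (x : X) (a : A)
    (m m' : Prob X) : l1 (G.trans x a m) (G.trans x a m') ≤ K * l1 m m' := by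
  have := h.2 x x a a m m'
  rw [← two_mul_tv, ← two_mul_tv]
  simp at this
  linarith

variable [Fintype A]

lemma Game.IsLipschitz.liftTrans_state (h : G.IsLipschitz L K) (hK : 0 ≤ K) (x x' : X)
    (u : Prob A) (m : Prob X) : l1 (G.liftTrans x u m) (G.liftTrans x' u m) ≤ K :=
  l1_mix_le_of_le (fun a => G.trans x a m) (fun a => G.trans x' a m) K
    (fun a => h.trans_state hK x x' a m) u

/-- Pure actions differ by up to `2 * K` in `ℓ¹`; the Dobrushin factor 1/2 leaves `K`. -/
lemma Game.IsLipschitz.liftTrans_action (h : G.IsLipschitz L K) (hK : 0 ≤ K) (x : X)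
    (u v : Prob A) (m : Prob X) : l1 (G.liftTrans x u m) (G.liftTrans x v m) ≤ K * l1 u v := by
  have := l1_mix_le (fun a => G.trans x a m) (2 * K) (fun a a' => h.trans_action hK x a a' m) u v
  rwa [mul_div_cancel_left₀ K two_ne_zero] at this

lemma Game.IsLipschitz.liftTrans_measure (h : G.IsLipschitz L K) (x : X)
    (u : Prob A) (m m' : Prob X) : l1 (G.liftTrans x u m) (G.liftTrans x u m') ≤ K * l1 m m' :=
  l1_mix_le_of_le (fun a => G.trans x a m) (fun a => G.trans x a m') _
    (fun a => h.trans_measure x a m m') u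

/-- Stability of the population update under changes of the population and of the actions. -/
lemma Game.IsLipschitz.next_le (h : G.IsLipschitz L K) (hK : 0 ≤ K) (m m' : Prob X)
    (b b' : X → Prob A) {M N : ℝ} (hM : ∀ x, l1 (b' x) (b x) ≤ M)
    (hN : ∀ x x', l1 (b x) (b x') ≤ N) :
    l1 (fun y => ∑ x, G.liftTrans x (b' x) m' y * m' x)
      (fun y => ∑ x, G.liftTrans x (b x) m y * m x)
      ≤ (K + (K + K * N) / 2) * l1 m' m + K * M := by
  -- Change the kernel with the state law `m'` fixed, then the state law with the kernel fixed; the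
  -- second change is a Dobrushin contraction.
  have h1 : l1 (fun y => ∑ x, G.liftTrans x (b' x) m' y * m' x)
      (fun y => ∑ x, G.liftTrans x (b x) m y * m' x) ≤ K * l1 m' m + K * M := by
    refine l1_mix_le_of_le (fun x => G.liftTrans x (b' x) m') (fun x => G.liftTrans x (b x) m) _
      (fun x => ?_) m'
    refine (l1_triangle _ (G.liftTrans x (b' x) m) _).trans (add_le_add ?_ ?_)
    · exact h.liftTrans_measure x _ _ _
    · exact (h.liftTrans_action hK x _ _ _).trans (mul_le_mul_of_nonneg_left (hM x) hK)
  have h2 := l1_mix_le (fun x => G.liftTrans x (b x) m) (K + K * N) (fun x x' =>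
    (l1_triangle _ (G.liftTrans x' (b x) m) _).trans (add_le_add
      (h.liftTrans_state hK x x' _ _)
      ((h.liftTrans_action hK x' _ _ _).trans (mul_le_mul_of_nonneg_left (hN x x') hK)))) m' m
  have h3 := l1_triangle (fun y => ∑ x, G.liftTrans x (b' x) m' y * m' x)
      (fun y => ∑ x, G.liftTrans x (b x) m y * m' x) (fun y => ∑ x, G.liftTrans x (b x) m y * m x)
  linarith

end Lipschitz

variable [Fintype A]

section Value

variable [Nonempty A] {ρ : ℝ} {Ω : (A → ℝ) → ℝ} {G : Game X A} {β L K : ℝ}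

lemma Game.exists_stationary_value (G : Game X A) (hΩ : IsRegularizer ρ Ω) (hβ0 : 0 ≤ β)
    (hβ1 : β < 1) (m : Prob X) : ∃ J : X → ℝ, ∀ x, J x = minCost Ω (G.actionCost β m J x) := by
  let F : (X → ℝ) → X → ℝ := fun J x => minCost Ω (G.actionCost β m J x)
  have hF : ContractingWith ⟨β, hβ0⟩ F := by
    refine ⟨hβ1, LipschitzWith.of_dist_le_mul fun J J' => ?_⟩
    change _ ≤ β * dist J J'
    rw [dist_pi_le_iff (by positivity)]
    intro x
    refine hΩ.abs_minCost_sub_le fun a => ?_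
    have h1 : G.actionCost β m J x a - G.actionCost β m J' x a
        = β * ∑ y, (J y - J' y) * G.trans x a m y := by
      simp only [Game.actionCost, sub_mul, Finset.sum_sub_distrib]; ring
    rw [h1, abs_mul, abs_of_nonneg hβ0]
    refine mul_le_mul_of_nonneg_left (Prob.abs_sum_mul_le _ _ (fun y => ?_) _) hβ0
    exact dist_le_pi_dist J J' y
  exact ⟨ContractingWith.fixedPoint F hF, fun x =>
    (congrFun (ContractingWith.fixedPoint_isFixedPt hF) x).symm⟩

omit [Fintype A] [Nonempty A] in
lemma Game.IsLipschitz.actionCost_state (h : G.IsLipschitz L K) (hL : 0 ≤ L) (hK : 0 ≤ K)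
    (hβ0 : 0 ≤ β) (m : Prob X) {J : X → ℝ} {s : ℝ} (hs : ∀ x x', |J x - J x'| ≤ s)
    (x x' : X) (a : A) :
    |G.actionCost β m J x a - G.actionCost β m J x' a| ≤ L + β * (s / 2 * K) := by
  have h1 : G.actionCost β m J x a - G.actionCost β m J x' a = (G.cost x a m - G.cost x' a m)
      + β * ∑ y, J y * (G.trans x a m y - G.trans x' a m y) := by
    simp only [Game.actionCost, mul_sub, Finset.sum_sub_distrib]; ring
  have hs0 : 0 ≤ s := (abs_nonneg _).trans (hs x x)
  rw [h1]
  refine (abs_add_le _ _).trans (add_le_add (h.cost_state hL x x' a m) ?_)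
  rw [abs_mul, abs_of_nonneg hβ0]
  refine mul_le_mul_of_nonneg_left ((abs_sum_mul_sub_le J s hs _ _).trans ?_) hβ0
  exact mul_le_mul_of_nonneg_left (h.trans_state hK x x' a m) (by positivity)

/-- The maximal oscillation `s` of `J` satisfies `s ≤ L + β * (s / 2 * K)` by the Bellman equation;
solve for `s`. -/
lemma Game.IsLipschitz.value_state (h : G.IsLipschitz L K) (hΩ : IsRegularizer ρ Ω) (hL : 0 ≤ L)
    (hK : 0 ≤ K) (hβ0 : 0 ≤ β) (hβK : β * K / 2 < 1) {m : Prob X} {J : X → ℝ}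
    (hJ : ∀ x, J x = minCost Ω (G.actionCost β m J x)) (x x' : X) :
    |J x - J x'| ≤ L / (1 - β * K / 2) := by
  have := Prob.nonempty m
  obtain ⟨⟨i, j⟩, hij⟩ := Finite.exists_max fun p : X × X => |J p.1 - J p.2|
  refine (hij (x, x')).trans ?_
  have h1 : |J i - J j| ≤ L + β * (|J i - J j| / 2 * K) := by
    conv_lhs => rw [hJ i, hJ j]
    exact hΩ.abs_minCost_sub_le
      (h.actionCost_state hL hK hβ0 m (fun y y' => hij (y, y')) i j)
  rw [le_div_iff₀ (by linarith)]
  change |J i - J j| * _ ≤ _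
  linarith

-- The change of transition is tested against `J` alone, so only `J` needs a bounded oscillation.
-- The finite-horizon value `J'` needs no regularity.
omit [Fintype A] [Nonempty A] in
lemma Game.IsLipschitz.actionCost_measure (h : G.IsLipschitz L K)
    (hβ0 : 0 ≤ β) (m m' : Prob X) {J : X → ℝ} (J' : X → ℝ) {s : ℝ}
    (hs : ∀ x x', |J x - J x'| ≤ s) (x : X) (a : A) :
    |G.actionCost β m' J' x a - G.actionCost β m J x a|
      ≤ (L + β * (s / 2 * K)) * l1 m' m + β * ‖J' - J‖ := by
  have h1 : G.actionCost β m' J' x a - G.actionCost β m J x a = (G.cost x a m' - G.cost x a m)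
      + (β * ∑ y, J y * (G.trans x a m' y - G.trans x a m y)
        + β * ∑ y, (J' y - J y) * G.trans x a m' y) := by
    simp only [Game.actionCost, mul_sub, sub_mul, Finset.sum_sub_distrib]; ring
  have hs0 : 0 ≤ s := (abs_nonneg _).trans (hs x x)
  have h2 : |β * ∑ y, J y * (G.trans x a m' y - G.trans x a m y)|
      ≤ β * (s / 2 * (K * l1 m' m)) := by
    rw [abs_mul, abs_of_nonneg hβ0]
    refine mul_le_mul_of_nonneg_left ((abs_sum_mul_sub_le J s hs _ _).trans ?_) hβ0
    exact mul_le_mul_of_nonneg_left (h.trans_measure x a m' m) (by positivity)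
  have h3 : |β * ∑ y, (J' y - J y) * G.trans x a m' y| ≤ β * ‖J' - J‖ := by
    rw [abs_mul, abs_of_nonneg hβ0]
    exact mul_le_mul_of_nonneg_left
      (Prob.abs_sum_mul_le _ _ (fun y => norm_le_pi_norm (J' - J) y) _) hβ0
  rw [h1]
  have h4 := abs_add_le (G.cost x a m' - G.cost x a m)
    (β * ∑ y, J y * (G.trans x a m' y - G.trans x a m y)
        + β * ∑ y, (J' y - J y) * G.trans x a m' y)
  have h5 := abs_add_le (β * ∑ y, J y * (G.trans x a m' y - G.trans x a m y))
    (β * ∑ y, (J' y - J y) * G.trans x a m' y)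
  have h6 := h.cost_measure x a m' m
  linarith

end Value

/-- A flow of policies and state measures, consistent up to time `T`, in which the policies are
best responses to the optimal values of the remaining horizon. -/
structure Game.IsGreedyFlow [MeasurableSpace X] [Nonempty A] (G : Game X A) (Ω : (A → ℝ) → ℝ)
    (β : ℝ) (T : ℕ) (π : ℕ → Policy X A) (μ : ℕ → Prob X) : Prop where
  markov : ∀ t, IsMarkovKernel (π t)
  flow : ∀ t < T, ∀ y, μ (t + 1) y = ∫ z, G.liftTrans z.1 z.2 (μ t) y ∂(joint (π t) (μ t))
  greedy : ∀ t ≤ T, ∀ x, μ t x ≠ 0 → ∀ᵐ u ∂π t x, u = bestResponse Ω (G.actionCost β (μ t)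
      (G.valueToGo Ω β μ (T + 1 - (t + 1)) (t + 1)) x)

/-! ### Greedy flows approach the stationary equilibrium. -/

section Convergence

variable [MeasurableSpace X] [MeasurableSingletonClass X]

lemma integral_joint_of_ae_eq {π : Policy X A} [IsMarkovKernel π] {ν : Prob X} {b : X → Prob A}
    (hb : ∀ x, ν x ≠ 0 → ∀ᵐ u ∂π x, u = b x) {g : X × Prob A → ℝ}
    (hg : ∀ x, Continuous fun u => g (x, u)) :
    ∫ z, g z ∂joint π ν = ∑ x, g (x, b x) * ν x := by
  rw [integral_joint π ν hg]
  refine Finset.sum_congr rfl fun x _ => ?_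
  by_cases hx : ν x = 0
  · simp [hx]
  · have : ∫ u, g (x, u) ∂π x = ∫ _, g (x, b x) ∂π x :=
      integral_congr_ae (by filter_upwards [hb x hx] with u hu; rw [hu])
    rw [this]
    simp [mul_comm]

variable [Nonempty A] {ρ : ℝ} {Ω : (A → ℝ) → ℝ} {G : Game X A} {β L K : ℝ}

/-- Away from the ends of the horizon, greedy flows are close to the stationary equilibrium. -/
lemma Game.Contracts.exists_interior_close (h : G.Contracts β ρ L K) (hΩ : IsRegularizer ρ Ω)
    (hβ0 : 0 ≤ β) (hβ1 : β < 1) {π : Policy X A} {m : Prob X} (hs : G.IsStationaryMFE Ω β π m)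
    {J : X → ℝ} (hJ : ∀ x, J x = minCost Ω (G.actionCost β m J x)) {η : ℝ} (hη : 0 < η) :
    ∀ᶠ N in atTop, ∀ T, 2 * N ≤ T → ∀ π' μ, G.IsGreedyFlow Ω β T π' μ → l1 (μ N) m ≤ η ∧
      ∀ x, l1 (bestResponse Ω (G.actionCost β (μ N)
          (G.valueToGo Ω β μ (T + 1 - (N + 1)) (N + 1)) x))
        (bestResponse Ω (G.actionCost β m J x)) ≤ η := by
  obtain ⟨hL, hK, hlip, hβK, hcon⟩ := h
  have hρ := hΩ.pos
  have h1β : 0 < 1 - β := by linarith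
  have h1K : 0 < 1 - β * K / 2 := by linarith
  set c := L / (1 - β * K / 2) with hc
  have hc0 : 0 ≤ c := by positivity
  have hspan : ∀ x x', |J x - J x'| ≤ c := hlip.value_state hΩ hL hK hβ0 hβK hJ
  -- Being a fixed point of `s ↦ L + β * (s / 2 * K)`, `c` bounds the oscillation of `J` and of the
  -- action costs over states, and their Lipschitz constant in the population.
  have hcc : L + β * (c / 2 * K) = c := by
    have : c * (1 - β * K / 2) = L := div_mul_cancel₀ _ h1K.ne'
    linarith
  have hcL : c ≤ Lbar β L K := by
    have : Lbar β L K = L + β * (c * K) := by rw [Lbar, hc]; ring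
    have h2 : 0 ≤ β * (c * K) := by positivity
    linarith
  -- The small-gain condition. The contraction condition is stronger: it has `Lbar` in place of `c`
  -- and an extra `1 / (1 - β)` inside `Kbar`.
  have hcoef : (K + (K + K * (c / ρ)) / 2) + K / ρ * c / (1 - β) < 1 := by
    refine lt_of_le_of_lt ?_ hcon
    have e1 : c / ρ ≤ Lbar β L K / (ρ * (1 - β)) :=
      div_le_div₀ (hc0.trans hcL) hcL (by positivity) (by nlinarith)
    have e2 : c / (ρ * (1 - β)) ≤ Lbar β L K / (ρ * (1 - β)) := by gcongr
    have e3 := mul_le_mul_of_nonneg_left e1 hK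
    have e4 := mul_le_mul_of_nonneg_left e2 hK
    have e5 : K / ρ * c / (1 - β) = K * (c / (ρ * (1 - β))) := by field_simp
    have e6 : Kbar β ρ L K = 3 * K / 2 + K * (Lbar β L K / (ρ * (1 - β))) / 2 := by
      rw [Kbar]; field_simp
    have e7 : Lbar β L K * K / (ρ * (1 - β)) = K * (Lbar β L K / (ρ * (1 - β))) := by ring
    rw [e5, e6, e7]
    linarith
  have hstep : ∀ (m' : Prob X) (J' : X → ℝ),
      ‖G.actionCost β m' J' - G.actionCost β m J‖ ≤ c * l1 m' m + β * ‖J' - J‖ := by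
    intro m' J'
    have h0 : 0 ≤ c * l1 m' m + β * ‖J' - J‖ :=
      add_nonneg (mul_nonneg hc0 (l1_nonneg _ _)) (mul_nonneg hβ0 (norm_nonneg _))
    refine (pi_norm_le_iff_of_nonneg h0).2 fun x => (pi_norm_le_iff_of_nonneg h0).2 fun a => ?_
    have := hlip.actionCost_measure hβ0 m m' J' hspan x a
    rwa [hcc] at this
  have habs : ∀ (q q' : X → A → ℝ) (x : X) (a : A), |q x a - q' x a| ≤ ‖q - q'‖ := fun q q' x a =>
    (norm_le_pi_norm ((q - q') x) a).trans (norm_le_pi_norm (q - q') x)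
  have hval : ∀ (m' : Prob X) (J' : X → ℝ), ‖(fun x => minCost Ω (G.actionCost β m' J' x)) - J‖
      ≤ ‖G.actionCost β m' J' - G.actionCost β m J‖ := by
    intro m' J'
    refine (pi_norm_le_iff_of_nonneg (norm_nonneg _)).2 fun x => ?_
    rw [Pi.sub_apply, hJ x]
    exact hΩ.abs_minCost_sub_le fun a => habs _ _ x a
  -- The ball of radius `R` around `J` contains the terminal value `0` and is invariant under every
  -- Bellman step, since `l1` is at most 2. The bound is thus uniform in the horizon and the flow.
  set R := ‖J‖ + 2 * c / (1 - β) with hR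
  have hR0 : 2 * c + β * R ≤ R := by
    have e : 2 * c / (1 - β) * (1 - β) = 2 * c := div_mul_cancel₀ _ h1β.ne'
    have := mul_nonneg h1β.le (norm_nonneg J)
    rw [hR]; linarith
  have hbase : ∀ (m' : Prob X) (J' : X → ℝ), ‖J' - J‖ ≤ R →
      ‖G.actionCost β m' J' - G.actionCost β m J‖ ≤ R := by
    intro m' J' hJ'
    have h2 := hstep m' J'
    have h3 := mul_le_mul_of_nonneg_left (l1_le_two m' m) hc0
    have h4 := mul_le_mul_of_nonneg_left hJ' hβ0
    linarith
  have hV : ∀ (μ : ℕ → Prob X) n t, ‖G.valueToGo Ω β μ n t - J‖ ≤ R := by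
    intro μ n
    induction n with
    | zero =>
      intro t
      have : 0 ≤ 2 * c / (1 - β) := by positivity
      simp only [Game.valueToGo, zero_sub, norm_neg, hR]
      linarith
    | succ n ih => exact fun t => (hval _ _).trans (hbase _ _ (ih _))
  obtain ⟨θ, B, κ, hθ0, hθ1, hκ, H⟩ := exists_interior_decay
    (a := K + (K + K * (c / ρ)) / 2) (b := K / ρ) (by positivity) (by positivity) hc0 hβ0 hβ1
    hcoef 2 R
  have ht : Tendsto (fun N : ℕ => B * θ ^ N) atTop (nhds 0) := by
    simpa using (tendsto_pow_atTop_nhds_zero_of_lt_one hθ0 hθ1).const_mul B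
  filter_upwards [ht.eventually_le_const hη,
    ht.eventually_le_const (u := κ * (ρ * η)) (by positivity)] with N hN1 hN2 T hT π' μ hμ
  let J' : ℕ → X → ℝ := fun t => G.valueToGo Ω β μ (T + 1 - (t + 1)) (t + 1)
  let b' : ℕ → X → Prob A := fun t x => bestResponse Ω (G.actionCost β (μ t) (J' t) x)
  let b : X → Prob A := fun x => bestResponse Ω (G.actionCost β m J x)
  let r : ℕ → ℝ := fun t => ‖G.actionCost β (μ t) (J' t) - G.actionCost β m J‖
  have hb' : ∀ t x, l1 (b' t x) (b x) ≤ r t / ρ := fun t x =>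
    hΩ.l1_bestResponse_le fun a => habs _ _ x a
  have hb : ∀ x x', l1 (b x) (b x') ≤ c / ρ := fun x x' =>
    hΩ.l1_bestResponse_le fun a => by
      have := hlip.actionCost_state hL hK hβ0 m hspan x x' a
      rwa [hcc] at this
  have hm : ∀ y, m y = ∑ x, G.liftTrans x (b x) m y * m x := fun y => by
    have := hs.markov
    rw [hs.flow y]
    exact integral_joint_of_ae_eq (hs.ae_eq hΩ hβ0 hβ1 hJ)
      (g := fun z => G.liftTrans z.1 z.2 m y) fun x => G.continuous_liftTrans x m y
  have hμ' : ∀ t < T, ∀ y, μ (t + 1) y = ∑ x, G.liftTrans x (b' t x) (μ t) y * μ t x :=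
    fun t ht y => by
    have := hμ.markov t
    rw [hμ.flow t ht y]
    exact integral_joint_of_ae_eq (hμ.greedy t ht.le)
      (g := fun z => G.liftTrans z.1 z.2 (μ t) y) fun x => G.continuous_liftTrans x (μ t) y
  obtain ⟨f1, f2⟩ := H T (fun t => l1 (μ t) m) r (fun t _ => l1_le_two _ _)
    (fun t _ => hbase _ _ (hV _ _ _)) (fun t ht => by
      have e := hlip.next_le hK m (μ t) b (b' t) (hb' t) hb
      rw [← funext hm, ← funext (hμ' t ht)] at e
      have e2 : K * (r t / ρ) = K / ρ * r t := by ring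
      rw [e2] at e
      exact e) (fun t ht => by
      refine (hstep (μ t) (J' t)).trans (add_le_add le_rfl (mul_le_mul_of_nonneg_left ?_ hβ0))
      have e : J' t = fun x => minCost Ω (G.actionCost β (μ (t + 1)) (J' (t + 1)) x) :=
        funext fun x => G.valueToGo_sub β μ (T := T + 1) (t := t + 1) (by omega) x
      rw [e]
      exact hval _ _) N N le_rfl (by omega)
  refine ⟨f1.trans hN1, fun x => (hb' N x).trans ?_⟩
  rw [div_le_iff₀ hρ]
  have := le_of_mul_le_mul_left (f2.trans hN2) hκ
  linarith

end Convergence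

/-! ### From states and actions to integrals of Lipschitz functions. -/

section Wasserstein

variable [MetricSpace X] [MeasurableSpace X] [MeasurableSingletonClass X]

omit [Fintype X] [MeasurableSpace X] [MeasurableSingletonClass X] in
lemma continuous_of_abs_sub_le {g : X × Prob A → ℝ}
    (hg : ∀ z z', |g z - g z'| ≤ dist z.1 z'.1 + ∑ a, |z.2 a - z'.2 a|) (x : X) :
    Continuous fun u => g (x, u) := by
  refine continuous_iff_continuousAt.2 fun v => tendsto_iff_dist_tendsto_zero.2 ?_
  have h0 : Tendsto (fun u : Prob A => ∑ a, |u a - v a|) (nhds v) (nhds 0) := by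
    have : Continuous fun u : Prob A => ∑ a, |u a - v a| :=
      continuous_finsetSum _ fun a _ => ((continuous_coord a).sub continuous_const).abs
    simpa using this.tendsto v
  refine squeeze_zero (fun _ => dist_nonneg) (fun u => ?_) h0
  simpa [Real.dist_eq] using hg (x, u) (x, v)

variable [Nonempty A] {ρ : ℝ} {Ω : (A → ℝ) → ℝ} {G : Game X A} {β L K : ℝ}

/-- Away from the ends of the horizon, the state-action laws of greedy flows are close to that of
the stationary equilibrium. -/
lemma Game.Contracts.exists_abs_integral_sub_le (h : G.Contracts β ρ L K)
    (hΩ : IsRegularizer ρ Ω) (hβ0 : 0 ≤ β) (hβ1 : β < 1) {π : Policy X A} {m : Prob X}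
    (hs : G.IsStationaryMFE Ω β π m) {η : ℝ} (hη : 0 < η) :
    ∀ᶠ N in atTop, ∀ T, 2 * N ≤ T → ∀ π' μ, G.IsGreedyFlow Ω β T π' μ →
      ∀ g : X × Prob A → ℝ, (∀ z z', |g z - g z'| ≤ dist z.1 z'.1 + ∑ a, |z.2 a - z'.2 a|) →
        |∫ z, g z ∂joint (π' N) (μ N) - ∫ z, g z ∂joint π m| ≤ η := by
  obtain ⟨J, hJ⟩ := G.exists_stationary_value hΩ hβ0 hβ1 m
  set D : ℝ := ∑ x : X, ∑ x' : X, dist x x' with hD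
  have hD0 : 0 ≤ D := Finset.sum_nonneg fun _ _ => Finset.sum_nonneg fun _ _ => dist_nonneg
  have hdist : ∀ x x' : X, dist x x' ≤ D := fun x x' =>
    (Finset.single_le_sum (f := fun x' => dist x x') (fun _ _ => dist_nonneg)
      (Finset.mem_univ x')).trans
    (Finset.single_le_sum (f := fun x => ∑ x', dist x x')
      (fun _ _ => Finset.sum_nonneg fun _ _ => dist_nonneg) (Finset.mem_univ x))
  -- `D + 2` bounds the oscillation of `x ↦ g (x, b x)`. The action error costs `η / (D + 2) ≤ η /
  -- 2` and the state error `η / 2`.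
  have hη' : 0 < η / (D + 2) := by positivity
  filter_upwards [h.exists_interior_close hΩ hβ0 hβ1 hs hJ hη'] with N hN T hT π' μ hμ g hg
  obtain ⟨h1, h2⟩ := hN T hT π' μ hμ
  have := hs.markov
  have := hμ.markov N
  rw [integral_joint_of_ae_eq (hμ.greedy N (by omega)) (continuous_of_abs_sub_le hg),
    integral_joint_of_ae_eq (hs.ae_eq hΩ hβ0 hβ1 hJ) (continuous_of_abs_sub_le hg)]
  set b := fun x => bestResponse Ω (G.actionCost β m J x)
  set b' := fun x => bestResponse Ω (G.actionCost β (μ N)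
    (G.valueToGo Ω β μ (T + 1 - (N + 1)) (N + 1)) x)
  change |∑ x, g (x, b' x) * μ N x - ∑ x, g (x, b x) * m x| ≤ η
  have h3 : ∑ x, g (x, b' x) * μ N x - ∑ x, g (x, b x) * m x
      = ∑ x, (g (x, b' x) - g (x, b x)) * μ N x + ∑ x, g (x, b x) * (μ N x - m x) := by
    simp only [mul_sub, sub_mul, Finset.sum_sub_distrib]; ring
  have h4 : |∑ x, (g (x, b' x) - g (x, b x)) * μ N x| ≤ η / (D + 2) :=
    Prob.abs_sum_mul_le _ _ (fun x => (hg _ _).trans (by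
      rw [dist_self, zero_add]; exact h2 x)) _
  have h5 : |∑ x, g (x, b x) * (μ N x - m x)| ≤ (D + 2) / 2 * l1 (μ N) m :=
    abs_sum_mul_sub_le (fun x => g (x, b x)) (D + 2) (fun x x' => (hg _ _).trans
      (add_le_add (hdist x x') (l1_le_two (b x) (b x')))) _ _
  have h6 : (D + 2) / 2 * l1 (μ N) m ≤ (D + 2) / 2 * (η / (D + 2)) := by gcongr
  have h7 : (D + 2) * (η / (D + 2)) = η := mul_div_cancel₀ _ (by positivity)
  have h8 : 0 ≤ D * (η / (D + 2)) := by positivity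
  rw [h3]
  refine (abs_add_le _ _).trans ?_
  linarith

end Wasserstein

end Turnpike

/-! ### Comparison of the two games. -/

section Comparison

variable {X A : Type*} [Fintype X] [Fintype A] [MeasurableSpace X]

lemma Game.IsFiniteMFE.isGreedyFlow [MeasurableSingletonClass X] [Nonempty A] {G : Game X A}
    {ρ β : ℝ} {Ω : (A → ℝ) → ℝ} {μ₀ : Prob X} {T : ℕ} {π : ℕ → Policy X A} {μ : ℕ → Prob X}
    (h : G.IsFiniteMFE Ω β μ₀ T π μ) (hΩ : IsRegularizer ρ Ω) (hβ : 0 < β) :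
    G.IsGreedyFlow Ω β T π μ :=
  ⟨h.markov, h.flow, fun _ ht x hx => h.ae_eq hΩ hβ ht x hx⟩

omit [Fintype X] in
lemma abs_integral_sub_le_of_W1_lt [MetricSpace X] {P Q : Measure (X × Prob A)} {ε : ℝ}
    (h : W1 P Q < ENNReal.ofReal ε) {g : X × Prob A → ℝ}
    (hg : ∀ z z', |g z - g z'| ≤ dist z.1 z'.1 + ∑ a, |z.2 a - z'.2 a|) :
    |∫ z, g z ∂P - ∫ z, g z ∂Q| ≤ ε := by
  have h1 := lt_of_le_of_lt (le_iSup₂ (f := fun (g : X × Prob A → ℝ)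
    (_ : ∀ z z', |g z - g z'| ≤ dist z.1 z'.1 + ∑ a, |z.2 a - z'.2 a|) =>
      ENNReal.ofReal |∫ z, g z ∂P - ∫ z, g z ∂Q|) g hg) h
  exact ((ENNReal.ofReal_lt_ofReal_iff_of_nonneg (abs_nonneg _)).1 h1).le

end Comparison

end MeanFieldGame

end

theorem mainTheorem10 {X A : Type*} [Fintype X] [MetricSpace X] [MeasurableSpace X]
    [MeasurableSingletonClass X] [Fintype A]
    (G G' : MeanFieldGame.Game X A) (Ω : (A → ℝ) → ℝ) (β ρ L K L' K' : ℝ)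
    (hβ0 : 0 ≤ β) (hβ1 : β < 1)
    (hΩ : MeanFieldGame.IsRegularizer ρ Ω)
    (hG : G.Contracts β ρ L K) (hG' : G'.Contracts β ρ L' K')
    (μ₀ : MeanFieldGame.Prob X) (ε : ℝ)
    (hclose : ∀ᶠ T in atTop, ∃ (π π' : ℕ → MeanFieldGame.Policy X A)
      (μ μ' : ℕ → MeanFieldGame.Prob X),
      G.IsFiniteMFE Ω β μ₀ T π μ ∧ G'.IsFiniteMFE Ω β μ₀ T π' μ' ∧
      ∀ t ≤ T, MeanFieldGame.W1 (MeanFieldGame.joint (π t) (μ t))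
        (MeanFieldGame.joint (π' t) (μ' t)) < ENNReal.ofReal ε)
    (hclose_zero : β = 0 → ∀ᶠ T in atTop, ∀ (π π' : ℕ → MeanFieldGame.Policy X A)
      (μ μ' : ℕ → MeanFieldGame.Prob X),
      G.IsFiniteMFE Ω β μ₀ T π μ → G'.IsFiniteMFE Ω β μ₀ T π' μ' →
      ∀ t ≤ T, MeanFieldGame.W1 (MeanFieldGame.joint (π t) (μ t))
        (MeanFieldGame.joint (π' t) (μ' t)) < ENNReal.ofReal ε)
    (π π' : MeanFieldGame.Policy X A) (μ μ' : MeanFieldGame.Prob X)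
    (hs : G.IsStationaryMFE Ω β π μ) (hs' : G'.IsStationaryMFE Ω β π' μ') :
    MeanFieldGame.W1 (MeanFieldGame.joint π μ) (MeanFieldGame.joint π' μ')
      < ENNReal.ofReal (3 * ε) := by
  obtain ⟨x₀⟩ := MeanFieldGame.Prob.nonempty μ₀
  have : Nonempty A := by
    have := hs.markov
    obtain ⟨u⟩ := (π x₀).nonempty_of_neZero
    exact MeanFieldGame.Prob.nonempty u
  -- A strict upper bound in `ℝ≥0∞` is positive.
  have hε : 0 < ε := by
    obtain ⟨T, _, _, _, _, _, _, h⟩ := hclose.exists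
    exact ENNReal.ofReal_pos.1 (zero_le.trans_lt (h 0 T.zero_le))
  have hgreedy : ∀ᶠ T in atTop, ∃ (π π' : ℕ → MeanFieldGame.Policy X A)
      (μ μ' : ℕ → MeanFieldGame.Prob X),
      G.IsGreedyFlow Ω β T π μ ∧ G'.IsGreedyFlow Ω β T π' μ' ∧
      ∀ t ≤ T, MeanFieldGame.W1 (MeanFieldGame.joint (π t) (μ t))
        (MeanFieldGame.joint (π' t) (μ' t)) < ENNReal.ofReal ε := by
    rcases hβ0.eq_or_lt with rfl | hβ
    · obtain ⟨p, m, hm, hg⟩ := G.exists_greedy_isFiniteMFE hΩ μ₀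
      obtain ⟨p', m', hm', hg'⟩ := G'.exists_greedy_isFiniteMFE hΩ μ₀
      filter_upwards [hclose_zero rfl] with T hT
      exact ⟨p, p', m, m', ⟨(hm T).markov, (hm T).flow, fun t _ x _ => hg t x _⟩,
        ⟨(hm' T).markov, (hm' T).flow, fun t _ x _ => hg' t x _⟩,
        hT p p' m m' (hm T) (hm' T)⟩
    · filter_upwards [hclose] with T hT
      obtain ⟨p, p', m, m', h, h', hW⟩ := hT
      exact ⟨p, p', m, m', h.isGreedyFlow hΩ hβ, h'.isGreedyFlow hΩ hβ, hW⟩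
  refine lt_of_le_of_lt (b := ENNReal.ofReal ε) (iSup₂_le fun g hg => ?_)
    ((ENNReal.ofReal_lt_ofReal_iff (by linarith)).2 (by linarith))
  refine ENNReal.ofReal_le_ofReal (le_of_forall_pos_le_add fun η hη => ?_)
  obtain ⟨N, hN, hN'⟩ := ((hG.exists_abs_integral_sub_le hΩ hβ0 hβ1 hs (half_pos hη)).and
    (hG'.exists_abs_integral_sub_le hΩ hβ0 hβ1 hs' (half_pos hη))).exists
  -- With `2 * N ≤ T`, time `N` is at distance at least `N` from both ends of the horizon.
  obtain ⟨T, ⟨p, p', m, m', h, h', hW⟩, hT⟩ := (hgreedy.and (eventually_ge_atTop (2 * N))).exists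
  have h1 := abs_le.1 (hN T hT p m h g hg)
  have h2 := abs_le.1 (hN' T hT p' m' h' g hg)
  have h3 := abs_le.1 (MeanFieldGame.abs_integral_sub_le_of_W1_lt (hW N (by omega)) hg)
  rw [abs_le]
  constructor <;> linarith [h1.1, h1.2, h2.1, h2.2, h3.1, h3.2]
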